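/- **The game.** Fix an integer $k\ge 2$. A simple weighted tree is a finite rooted tree $T$ with root $r$ in which every vertex $u\neq r$ has a parent $p(u)$ and an edge $(u,p(u))$ of length $d_u>0$, and no vertex other than possibly the root has degree $2$. A configuration $x\in\mathcal X(T)$ places $k$ robots on the leaves of $T$ (a lone root counts as a leaf); for robots located at vertices of $T$, $x_u$ denotes the number of robots at descendants of $u$ (including $u$), and $\mathrm{OT}_T(x,x')=\sum_{u\ne r}d_u|x_u-x'_u|$. In the continuous tree-mining game the state is a simple weighted tree $T$ with a configuration $x$; initially $T$ has a single leaf (it is the lone root or a single edge), which holds all $k$ robots, and the cost is $0$. The adversary may - elongate continuously, at unit rate, the edge leading to a leaf $\ell\neq r$ with $x_\ell\ge 2$; the player pays at rate $x_\ell$ and may re-allocate robots at any instant $t$, paying $\mathrm{OT}_{T(t)}(x,x')$; - fork a leaf $\ell$ with $x_\ell\ge3$ into $m\in\{2,\dots,x_\ell-1\}$ new children, at a distance $\delta\in(0,1)$ from $\ell$ that is chosen by the player; the player must assign the $x_\ell$ robots to the new leaves and pays $\mathrm{OT}_{T'}(x,x')$, where $T'$ is the new tree; - kill a leaf $\ell$,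 provided that another leaf exists: $\ell$ and its edge are removed, and if $p(\ell)\ne r$ is left with only one child $u$, then $p(\ell)$ is suppressed and $u$ is joined to $p(p(\ell))$ by an edge of length $d_{p(\ell)}+d_u$; the player must move to a configuration $x'$ on the new tree and pays $\mathrm{OT}_T(x,x')$, where $T$ is the tree before the kill. A strategy consists of a function $\mathcal A(T,x,T')\in\mathcal X(T')$, giving the new configuration when the tree becomes $T'$ (with $T'=T$ at the instants of an elongation), and of a choice of the fork lengths $\delta$. Given $f(\cdot,\cdot)$, the strategy is $f(k,D)$-bounded if it obeys these rules, does not stall the game (during an elongation the player's moves occur at well-defined instants and do not accumulate) and, however the adversary plays, the accumulated cost is at all times at most $f(k,D)$, where $D$ is the current depth of the highest leaf (the least distance from the root to a leaf). **Theorem.** There are a function $f$ and a constant $C$ with $|f(k,D)|\le C\,k^2D$ for all integers $k\ge2$ and real $D\ge0$, such that for every $k\ge 2$ there is an $f(k,D)$-bounded strategy of the player in the continuous tree-mining game with $k$ robots. Moreover, the strategy can be taken to be a greedy rule $$\mathcal A(T,x,T')\in\operatorname*{argmin}_{x'\in\mathcal X(T')}\ \Psi(T',x')+\mathrm{OT}(x,x'),\qquad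 \Psi(T,x)=\sum_{u\neq r}d_u\,\phi(x_u),\qquad \phi(y)=20ky+5y^2,$$ where $\mathrm{OT}$ is taken in $T'$ if $T'=T$ or $T'$ arises by a fork, and in $T$ if $T'$ arises by a kill, and where for $T'=T$ ties are broken in favor of $x'\ne x$. -/

import Mathlib

namespace CTM

/-- Data of a finite rooted weighted tree. The vertices are natural numbers and the root is `0`;
`parent u` and `len u` are the parent of `u` and the length `d_u` of the edge `(u, parent u)`. -/
@[ext]
structure WTree where
  verts : Finset ℕ
  parent : ℕ → ℕ
  len : ℕ → ℝ

namespace WTree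

/-- The children of a vertex. -/
def children (T : WTree) (u : ℕ) : Finset ℕ :=
  (T.verts.erase 0).filter fun v => T.parent v = u

/-- The leaves: the vertices without children (so a lone root is a leaf). -/
def leaves (T : WTree) : Finset ℕ :=
  T.verts.filter fun u => T.children u = ∅

/-- `v ⪯ u`: the vertex `u` is obtained from `v` by iterating the parent map. -/
def Desc (T : WTree) (v u : ℕ) : Prop :=
  ∃ n : ℕ, T.parent^[n] v = u

/-- `T` is a simple weighted tree: every vertex is joined to the root `0` by its chain of parents,
edges have positive length, and no vertex other than the root has degree two (that is, exactly one
child). The last three fields only fix the values of `parent` and `len` where they carry no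
information. -/
structure IsSimpleTree (T : WTree) : Prop where
  root_mem : 0 ∈ T.verts
  parent_mem : ∀ u ∈ T.verts, T.parent u ∈ T.verts
  desc_root : ∀ u ∈ T.verts, T.Desc u 0
  len_pos : ∀ u ∈ T.verts, u ≠ 0 → 0 < T.len u
  simple : ∀ u ∈ T.verts, u ≠ 0 → (T.children u).card ≠ 1
  parent_root : T.parent 0 = 0
  len_root : T.len 0 = 0
  off_verts : ∀ u ∉ T.verts, T.parent u = u ∧ T.len u = 0

open Classical in
/-- The number `x_u` of robots located at the descendants of `u` (including `u`). -/
noncomputable def mass (T : WTree) (x : ℕ → ℕ) (u : ℕ) : ℕ :=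
  ∑ v ∈ T.verts with T.Desc v u, x v

open Classical in
/-- The distance from a vertex to the root. -/
noncomputable def depth (T : WTree) (v : ℕ) : ℝ :=
  ∑ u ∈ (T.verts.erase 0) with T.Desc v u, T.len u

/-- The depth of the highest leaf, i.e. of the leaf that is closest to the root. -/
noncomputable def highestLeafDepth (T : WTree) : ℝ :=
  sInf (T.depth '' (T.leaves : Set ℕ))

/-- The discrete configurations of `k` robots on the leaves of `T`. -/
def configs (T : WTree) (k : ℕ) : Set (ℕ → ℕ) :=
  {x | (∀ u ∉ T.leaves, x u = 0) ∧ ∑ u ∈ T.leaves, x u = k}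

/-- The optimal transport cost `∑_u d_u |x_u - x'_u|` on `T`, for robots located at vertices
of `T`. -/
noncomputable def OT (T : WTree) (x x' : ℕ → ℕ) : ℝ :=
  ∑ u ∈ T.verts.erase 0, T.len u * |(T.mass x u : ℝ) - (T.mass x' u : ℝ)|

/-- The potential `Ψ(T, x) = ∑_{u ≠ r} d_u φ(x_u)`. -/
noncomputable def potential (T : WTree) (φ : ℝ → ℝ) (x : ℕ → ℕ) : ℝ :=
  ∑ u ∈ T.verts.erase 0, T.len u * φ (T.mass x u)

/-- The edge leading to `l` becomes longer by `s`. -/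
noncomputable def elongate (T : WTree) (l : ℕ) (s : ℝ) : WTree where
  verts := T.verts
  parent := T.parent
  len := Function.update T.len l (T.len l + s)

/-- The leaf `l` receives the new vertices in `S` as children, by edges of length `δ`. -/
noncomputable def fork (T : WTree) (l : ℕ) (S : Finset ℕ) (δ : ℝ) : WTree where
  verts := T.verts ∪ S
  parent := fun v => if v ∈ S then l else T.parent v
  len := fun v => if v ∈ S then δ else T.len v

/-- The siblings of a vertex. -/
def siblings (T : WTree) (l : ℕ) : Finset ℕ :=
  (T.children (T.parent l)).erase l

/-- The leaf `l` and its edge are removed. If its parent `p` is not the root and is left with only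
one child `u`, then `p` is suppressed and `u` is attached to the parent of `p` by an edge of length
`d_p + d_u`. -/
noncomputable def kill (T : WTree) (l : ℕ) : WTree :=
  let p := T.parent l
  if p ≠ 0 ∧ (T.siblings l).card = 1 then
    { verts := (T.verts.erase l).erase p
      parent := fun v =>
        if v = l ∨ v = p then v else if v ∈ T.siblings l then T.parent p else T.parent v
      len := fun v =>
        if v = l ∨ v = p then 0 else if v ∈ T.siblings l then T.len p + T.len v else T.len v }
  else
    { verts := T.verts.erase l
      parent := fun v => if v = l then v else T.parent v
      len := fun v => if v = l then 0 else T.len v }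

/-- The adversary may elongate `l`: it is a leaf with an edge and at least two robots. -/
def CanElongate (T : WTree) (x : ℕ → ℕ) (l : ℕ) : Prop :=
  l ∈ T.leaves ∧ l ≠ 0 ∧ 2 ≤ x l

/-- The adversary may fork `l`, with the elements of `S` as new leaves: the number `m` of new leaves
satisfies `2 ≤ m ≤ x_l - 1`. -/
def CanFork (T : WTree) (x : ℕ → ℕ) (l : ℕ) (S : Finset ℕ) : Prop :=
  l ∈ T.leaves ∧ Disjoint S T.verts ∧ 2 ≤ S.card ∧ S.card + 1 ≤ x l

/-- The adversary may kill `l`: it is a leaf, and some other leaf stays alive. -/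
def CanKill (T : WTree) (l : ℕ) : Prop :=
  l ∈ T.leaves ∧ ∃ l' ∈ T.leaves, l' ≠ l

end WTree

/-- A strategy of the player with `k` robots. `move T x T'` is the new configuration on the modified
tree `T'`, given the previous tree `T` and configuration `x`; it is used with `T' = T` while a leaf
is elongated. `forkLength T x l m` is the length of the new edges that the player chooses when the
leaf `l` is forked into `m` children. -/
structure Strategy (k : ℕ) where
  move : WTree → (ℕ → ℕ) → WTree → (ℕ → ℕ)
  forkLength : WTree → (ℕ → ℕ) → ℕ → ℕ → ℝ
  move_mem : ∀ T x T', T.IsSimpleTree → x ∈ T.configs k → T'.IsSimpleTree →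
    move T x T' ∈ T'.configs k
  forkLength_pos : ∀ T x l m, 0 < forkLength T x l m
  forkLength_lt_one : ∀ T x l m, forkLength T x l m < 1

namespace Strategy

variable {k : ℕ}

/-- The answer of the player at an instant at which the tree is `T`. -/
def respond (A : Strategy k) (T : WTree) (x : ℕ → ℕ) : ℕ → ℕ :=
  A.move T x T

/-- In configuration `x` the player moves no robot while the leaf `l` of `T` is being elongated by
`s`, before the end of that elongation. -/
def QuietUntil (A : Strategy k) (T : WTree) (x : ℕ → ℕ) (l : ℕ) (s : ℝ) : Prop :=
  ∀ t : ℝ, 0 ≤ t → t < s → A.respond (T.elongate l t) x = x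

/-- The tree after a fork, with the length chosen by the player. -/
noncomputable def forkTree (A : Strategy k) (T : WTree) (x : ℕ → ℕ) (l : ℕ) (S : Finset ℕ) :
    WTree :=
  T.fork l S (A.forkLength T x l S.card)

/-- `A.Reach T x c`: against the strategy `A`, the adversary can bring the game to the tree `T` with
configuration `x` and accumulated cost `c`. The game starts with all robots on the only leaf of a
simple weighted tree (a lone root or a single edge) and cost `0`. An elongation is cut into pieces
during which no robot moves; the player reacts at the end of each piece. -/
inductive Reach (A : Strategy k) : WTree → (ℕ → ℕ) → ℝ → Prop
  | start (T : WTree) (l : ℕ) : T.IsSimpleTree → T.leaves = {l} → Reach A T (Pi.single l k) 0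
  | wait (T : WTree) (x : ℕ → ℕ) (c : ℝ) : Reach A T x c →
      Reach A T (A.respond T x) (c + T.OT x (A.respond T x))
  | elongate (T : WTree) (x : ℕ → ℕ) (c : ℝ) (l : ℕ) (s : ℝ) : Reach A T x c →
      T.CanElongate x l → 0 < s → A.QuietUntil T x l s →
      Reach A (T.elongate l s) (A.respond (T.elongate l s) x)
        (c + s * x l + (T.elongate l s).OT x (A.respond (T.elongate l s) x))
  | fork (T : WTree) (x : ℕ → ℕ) (c : ℝ) (l : ℕ) (S : Finset ℕ) : Reach A T x c →
      T.CanFork x l S →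
      Reach A (A.forkTree T x l S) (A.move T x (A.forkTree T x l S))
        (c + (A.forkTree T x l S).OT x (A.move T x (A.forkTree T x l S)))
  | kill (T : WTree) (x : ℕ → ℕ) (c : ℝ) (l : ℕ) : Reach A T x c →
      T.CanKill l →
      Reach A (T.kill l) (A.move T x (T.kill l)) (c + T.OT x (A.move T x (T.kill l)))

/-- `A.Sustains l T x r`: from the tree `T` with configuration `x`, an adversary who keeps elongating
the leaf `l` for a total duration `r` is only stopped, after finitely many moves of the player,
because the duration has elapsed or because `l` has at most one robot. -/
inductive Sustains (A : Strategy k) (l : ℕ) : WTree → (ℕ → ℕ) → ℝ → Prop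
  | done (T : WTree) (x : ℕ → ℕ) : Sustains A l T x 0
  | blocked (T : WTree) (x : ℕ → ℕ) (r : ℝ) : x l ≤ 1 → Sustains A l T x r
  | wait (T : WTree) (x : ℕ → ℕ) (r : ℝ) : Sustains A l T (A.respond T x) r → Sustains A l T x r
  | elongate (T : WTree) (x : ℕ → ℕ) (r s : ℝ) : 2 ≤ x l → 0 < s → s ≤ r →
      A.QuietUntil T x l s →
      Sustains A l (T.elongate l s) (A.respond (T.elongate l s) x) (r - s) → Sustains A l T x r

/-- The strategy obeys the rules in every state that can occur: at a fork it sends the robots of the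
forked leaf to the new leaves, and it never stalls time (its moves during an elongation occur at well
defined instants and do not accumulate). -/
structure IsLegal (A : Strategy k) : Prop where
  fork_keeps : ∀ (T : WTree) (x : ℕ → ℕ) (c : ℝ) (l : ℕ) (S : Finset ℕ), A.Reach T x c → T.CanFork x l S →
    ∀ u ∈ T.leaves, u ≠ l → A.move T x (A.forkTree T x l S) u = x u
  sustains : ∀ (T : WTree) (x : ℕ → ℕ) (c : ℝ) (l : ℕ) (r : ℝ), A.Reach T x c → T.CanElongate x l → 0 < r → A.Sustains l T x r

/-- The strategy is `f(k, D)`-bounded: however the adversary plays, the cost is at all times at most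
`f(k, D)`, where `D` is the current depth of the highest leaf. -/
def IsBounded (A : Strategy k) (f : ℕ → ℝ → ℝ) : Prop :=
  A.IsLegal ∧ ∀ T x c, A.Reach T x c → c ≤ f k T.highestLeafDepth

/-- The strategy is the greedy rule `argmin_{x'} Ψ(T', x') + OT(x, x')`, the minimum being over all
configurations `x'` on the modified tree `T'`, with ties broken in favor of `x' ≠ x`. The transport
takes place in `T` if a leaf of `T` is killed, and in `T'` if a leaf is forked. -/
structure IsGreedy (A : Strategy k) (φ : ℝ → ℝ) : Prop where
  stay : ∀ (T : WTree) (x : ℕ → ℕ), T.IsSimpleTree → x ∈ T.configs k → ∀ z ∈ T.configs k,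
    T.potential φ (A.respond T x) + T.OT x (A.respond T x) ≤ T.potential φ z + T.OT x z
  ties : ∀ (T : WTree) (x : ℕ → ℕ), T.IsSimpleTree → x ∈ T.configs k → A.respond T x = x →
    ∀ z ∈ T.configs k, z ≠ x → T.potential φ x < T.potential φ z + T.OT x z
  fork : ∀ (T : WTree) (x : ℕ → ℕ) (l : ℕ) (S : Finset ℕ) (δ : ℝ), T.IsSimpleTree →
    x ∈ T.configs k → T.CanFork x l S → 0 < δ → δ ≤ 1 →
    ∀ z ∈ (T.fork l S δ).configs k,
      (T.fork l S δ).potential φ (A.move T x (T.fork l S δ))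
          + (T.fork l S δ).OT x (A.move T x (T.fork l S δ)) ≤
        (T.fork l S δ).potential φ z + (T.fork l S δ).OT x z
  kill : ∀ (T : WTree) (x : ℕ → ℕ) (l : ℕ), T.IsSimpleTree → x ∈ T.configs k → T.CanKill l →
    ∀ z ∈ (T.kill l).configs k,
      (T.kill l).potential φ (A.move T x (T.kill l)) + T.OT x (A.move T x (T.kill l)) ≤
        (T.kill l).potential φ z + T.OT x z

end Strategy

end CTM

/-!
At rest, every transport from the greedy configuration `x` costs more than it lowers the potential.
The cost `c` of the player satisfies `c + Ψ x ≤ 21 * min Ψ` throughout the game: a transport that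
the greedy player carries out is paid for by a loss of potential, and an elongation or a fork raises
`21 * min Ψ` at least as much as `c + Ψ x`. For a kill of `l`, let `m n` be the minimum of `Ψ` over
the configurations with at most `n` robots on `l`. Convexity of `φ` makes the robots leave `l` one
after the other, each paying about the increment `m n - m (n + 1)`. The last of these increments is
large, because an empty leaf attracts a robot, and the sum of all of them is at most the increase of
`min Ψ` under the kill. Finally, all robots on the highest leaf give
`min Ψ ≤ φ k * D = 25 * k ^ 2 * D`, and `525 = 21 * 25`.
-/

namespace CTM

namespace WTree

variable {T : WTree} {k : ℕ}

/-- A tree in the sense of `IsSimpleTree` in which vertices of degree two are allowed. These occur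
between the two steps of a kill. -/
structure IsTree (T : WTree) : Prop where
  root_mem : 0 ∈ T.verts
  parent_mem : ∀ u ∈ T.verts, T.parent u ∈ T.verts
  desc_root : ∀ u ∈ T.verts, T.Desc u 0
  len_pos : ∀ u ∈ T.verts, u ≠ 0 → 0 < T.len u
  parent_root : T.parent 0 = 0
  len_root : T.len 0 = 0
  off_verts : ∀ u ∉ T.verts, T.parent u = u ∧ T.len u = 0

theorem IsSimpleTree.isTree (hT : T.IsSimpleTree) : T.IsTree where
  __ := hT

theorem IsTree.isSimpleTree (hT : T.IsTree)
    (h : ∀ u ∈ T.verts, u ≠ 0 → (T.children u).card ≠ 1) : T.IsSimpleTree where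
  __ := hT
  simple := h

theorem mem_children {u c : ℕ} : c ∈ T.children u ↔ c ≠ 0 ∧ c ∈ T.verts ∧ T.parent c = u := by
  simp [children, and_assoc]

theorem mem_leaves {u : ℕ} : u ∈ T.leaves ↔ u ∈ T.verts ∧ T.children u = ∅ := by
  simp [leaves]

theorem notMem_leaves_of_mem_children {u c : ℕ} (hc : c ∈ T.children u) : u ∉ T.leaves :=
  fun hu => Finset.ne_empty_of_mem hc (mem_leaves.1 hu).2

theorem Desc.refl (T : WTree) (v : ℕ) : T.Desc v v := ⟨0, rfl⟩

theorem Desc.trans {a b c : ℕ} (h₁ : T.Desc a b) (h₂ : T.Desc b c) : T.Desc a c := by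
  obtain ⟨n, rfl⟩ := h₁
  obtain ⟨m, rfl⟩ := h₂
  exact ⟨m + n, Function.iterate_add_apply _ _ _ _⟩

theorem desc_parent (T : WTree) (v : ℕ) : T.Desc v (T.parent v) := ⟨1, rfl⟩

theorem desc_of_mem_children {u c : ℕ} (h : c ∈ T.children u) : T.Desc c u :=
  (mem_children.1 h).2.2 ▸ T.desc_parent c

theorem Desc.total {v a b : ℕ} (ha : T.Desc v a) (hb : T.Desc v b) :
    T.Desc a b ∨ T.Desc b a := by
  obtain ⟨n, rfl⟩ := ha
  obtain ⟨m, rfl⟩ := hb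
  refine (le_total n m).imp (fun h => ⟨m - n, ?_⟩) fun h => ⟨n - m, ?_⟩ <;>
    rw [← Function.iterate_add_apply, Nat.sub_add_cancel h]

theorem desc_iff {v u : ℕ} : T.Desc v u ↔ v = u ∨ T.Desc (T.parent v) u := by
  constructor
  · rintro ⟨_ | n, rfl⟩
    exacts [Or.inl rfl, Or.inr ⟨n, rfl⟩]
  · rintro (rfl | h)
    exacts [Desc.refl T v, (T.desc_parent v).trans h]

theorem desc_sibling_of_not_desc {a b f u v : ℕ} (hb : b ∈ T.children a) (hfb : T.Desc f b)
    (hva : T.Desc v a) (hfu : T.Desc f u) (hvu : ¬ T.Desc v u) : T.Desc u b := by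
  rcases hfu.total hfb with hub | hbu
  · exact hub
  · rcases desc_iff.1 hbu with rfl | hau
    · exact Desc.refl T b
    · rw [(mem_children.1 hb).2.2] at hau
      exact absurd (hva.trans hau) hvu

open Classical in
/-- The vertices whose edges lead from `a` up to the path from `b` to the root. The path from `a`
to `b` consists of the edges of `T.up a b` and `T.up b a`. -/
noncomputable def up (T : WTree) (a b : ℕ) : Finset ℕ :=
  (T.verts.erase 0).filter fun u => T.Desc a u ∧ ¬ T.Desc b u

theorem mem_up {a b u : ℕ} :
    u ∈ T.up a b ↔ (u ≠ 0 ∧ u ∈ T.verts) ∧ T.Desc a u ∧ ¬ T.Desc b u := by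
  simp only [up, Finset.mem_filter, Finset.mem_erase]

theorem sum_verts {y : ℕ → ℕ} (hy : y ∈ T.configs k) : ∑ v ∈ T.verts, y v = k := by
  rw [← hy.2]
  exact (Finset.sum_subset (Finset.filter_subset _ _) fun v _ hv => hy.1 v hv).symm

theorem mass_le {y : ℕ → ℕ} (hy : y ∈ T.configs k) (u : ℕ) : T.mass y u ≤ k := by
  classical
  rw [← sum_verts hy]
  exact Finset.sum_le_sum_of_subset (Finset.filter_subset _ _)

theorem mass_add (y z : ℕ → ℕ) (u : ℕ) : T.mass (y + z) u = T.mass y u + T.mass z u :=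
  Finset.sum_add_distrib

open Classical in
theorem mass_single {v : ℕ} (hv : v ∈ T.verts) (n u : ℕ) :
    T.mass (Pi.single v n) u = if T.Desc v u then n else 0 := by
  simp [mass, hv]

namespace IsTree

theorem root_induction (hT : T.IsTree) {P : ∀ v, v ∈ T.verts → Prop} (root : P 0 hT.root_mem)
    (step : ∀ v (hv : v ∈ T.verts), v ≠ 0 → P (T.parent v) (hT.parent_mem v hv) → P v hv) {v : ℕ}
    (hv : v ∈ T.verts) : P v hv := by
  obtain ⟨n, hn⟩ := hT.desc_root v hv
  induction n generalizing v with
  | zero =>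
    obtain rfl : v = 0 := hn
    exact root
  | succ n ih =>
    rcases eq_or_ne v 0 with rfl | hv0
    · exact root
    · exact step v hv hv0 (ih (hT.parent_mem v hv) hn)

theorem desc_mem (hT : T.IsTree) {v u : ℕ} (hv : v ∈ T.verts) (h : T.Desc v u) :
    u ∈ T.verts := by
  obtain ⟨n, rfl⟩ := h
  induction n with
  | zero => exact hv
  | succ n ih => rw [Function.iterate_succ_apply']; exact hT.parent_mem _ ih

theorem eq_zero_of_desc_zero (hT : T.IsTree) {u : ℕ} (h : T.Desc 0 u) : u = 0 := by
  obtain ⟨n, rfl⟩ := h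
  exact Function.iterate_fixed hT.parent_root n

theorem parent_ne (hT : T.IsTree) {v : ℕ} (hv : v ∈ T.verts) (hv0 : v ≠ 0) : T.parent v ≠ v := by
  intro h
  obtain ⟨n, hn⟩ := hT.desc_root v hv
  exact hv0 (by rw [← hn, Function.iterate_fixed h])

theorem antisymm (hT : T.IsTree) {v u : ℕ} (hv : v ∈ T.verts) (hvu : T.Desc v u)
    (huv : T.Desc u v) : v = u := by
  induction hv using hT.root_induction generalizing u with
  | root => exact (hT.eq_zero_of_desc_zero hvu).symm
  | step v hv hv0 ih =>
    refine (desc_iff.1 hvu).resolve_right fun hpu => ?_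
    exact hT.parent_ne hv hv0 (ih (hpu.trans huv) (T.desc_parent v))

theorem not_desc_child (hT : T.IsTree) {u c : ℕ} (hc : c ∈ T.children u) : ¬ T.Desc u c := by
  intro h
  obtain ⟨hc0, hcv, hp⟩ := mem_children.1 hc
  exact hT.parent_ne hcv hc0 (hp.trans (hT.antisymm hcv (desc_of_mem_children hc) h).symm)

theorem exists_child (hT : T.IsTree) {v u : ℕ} (hv : v ∈ T.verts) (h : T.Desc v u)
    (hne : v ≠ u) : ∃ c ∈ T.children u, T.Desc v c := by
  induction hv using hT.root_induction with
  | root => exact absurd (hT.eq_zero_of_desc_zero h).symm hne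
  | step v hv hv0 ih =>
    by_cases hp : T.parent v = u
    · exact ⟨v, mem_children.2 ⟨hv0, hv, hp⟩, Desc.refl T v⟩
    · obtain ⟨c, hc, hd⟩ := ih ((desc_iff.1 h).resolve_left hne) hp
      exact ⟨c, hc, (T.desc_parent v).trans hd⟩

theorem child_unique (hT : T.IsTree) {v u c c' : ℕ} (hc : c ∈ T.children u)
    (hc' : c' ∈ T.children u) (h : T.Desc v c) (h' : T.Desc v c') : c = c' := by
  by_contra hne
  have not_desc {a b : ℕ} (ha : a ∈ T.children u) (hb : b ∈ T.children u) (hab : a ≠ b) :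
      ¬ T.Desc a b := by
    rw [desc_iff, (mem_children.1 ha).2.2]
    exact not_or.2 ⟨hab, hT.not_desc_child hb⟩
  exact (h.total h').elim (not_desc hc hc' hne) (not_desc hc' hc (Ne.symm hne))

theorem eq_of_desc_leaf (hT : T.IsTree) {v f : ℕ} (hv : v ∈ T.verts) (hf : f ∈ T.leaves)
    (h : T.Desc v f) : v = f := by
  by_contra hne
  obtain ⟨c, hc, -⟩ := hT.exists_child hv h hne
  exact notMem_leaves_of_mem_children hc hf

theorem leaf_ne_zero_of_ne (hT : T.IsTree) {l j : ℕ} (hl : l ∈ T.leaves) (hj : j ∈ T.verts)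
    (hjl : j ≠ l) : l ≠ 0 := by
  rintro rfl
  exact hjl (hT.eq_of_desc_leaf hj hl (hT.desc_root j hj))

open Classical in
theorem leaf_induction (hT : T.IsTree) {P : ∀ u, u ∈ T.verts → Prop}
    (step : ∀ u (hu : u ∈ T.verts), (∀ c (hc : c ∈ T.children u), P c (mem_children.1 hc).2.1) →
      P u hu) {u : ℕ} (hu : u ∈ T.verts) : P u hu := by
  induction hn : (T.verts.filter (T.Desc · u)).card using Nat.strong_induction_on
    generalizing u with
  | _ n ih =>
    refine step u hu fun c hc => ih _ ?_ (mem_children.1 hc).2.1 rfl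
    rw [← hn]
    refine Finset.card_lt_card (Finset.ssubset_iff_of_subset ?_ |>.2 ⟨u, ?_, ?_⟩)
    · exact Finset.monotone_filter_right _ fun v _ h => h.trans (desc_of_mem_children hc)
    · exact Finset.mem_filter.2 ⟨hu, Desc.refl T u⟩
    · exact fun h => hT.not_desc_child hc (Finset.mem_filter.1 h).2

theorem exists_leaf_path (hT : T.IsTree) {R : ℕ → Prop}
    (hR : ∀ u ∈ T.verts, u ∉ T.leaves → R u → ∃ c ∈ T.children u, R c) {u : ℕ}
    (hu : u ∈ T.verts) (h : R u) :
    ∃ f ∈ T.leaves, T.Desc f u ∧ ∀ v, T.Desc f v → T.Desc v u → R v := by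
  induction hu using hT.leaf_induction with
  | step u hu ih =>
    by_cases hl : u ∈ T.leaves
    · exact ⟨u, hl, Desc.refl T u, fun v huv hvu => hT.antisymm hu huv hvu ▸ h⟩
    · obtain ⟨c, hc, hRc⟩ := hR u hu hl h
      obtain ⟨f, hf, hfc, hpath⟩ := ih c hc hRc
      refine ⟨f, hf, hfc.trans (desc_of_mem_children hc), fun v hfv hvu => ?_⟩
      by_cases huv : T.Desc u v
      · rwa [← hT.antisymm hu huv hvu]
      · exact hpath v hfv (desc_sibling_of_not_desc hc hfc (Desc.refl T u) hfv huv)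

theorem exists_last_ancestor (hT : T.IsTree) {P : ℕ → Prop} {v : ℕ} (hv : v ∈ T.verts)
    (hPv : P v) (h0 : ¬ P 0) :
    ∃ a, ∃ c ∈ T.children a, T.Desc v c ∧ ¬ P a ∧ ∀ u, T.Desc v u → T.Desc u c → P u := by
  induction hv using hT.root_induction with
  | root => exact absurd hPv h0
  | step v hv hv0 ih =>
    by_cases hp : P (T.parent v)
    · obtain ⟨a, c, hc, hvc, hPa, hpath⟩ := ih hp
      refine ⟨a, c, hc, (T.desc_parent v).trans hvc, hPa, fun u hvu huc => ?_⟩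
      rcases desc_iff.1 hvu with rfl | hpu
      exacts [hPv, hpath u hpu huc]
    · refine ⟨T.parent v, v, mem_children.2 ⟨hv0, hv, rfl⟩, Desc.refl T v, hp, fun u hvu huv => ?_⟩
      rwa [← hT.antisymm hv hvu huv]

open Classical in
theorem mass_eq (hT : T.IsTree) (y : ℕ → ℕ) {u : ℕ} (hu : u ∈ T.verts) :
    T.mass y u = y u + ∑ c ∈ T.children u, T.mass y c := by
  have hsplit : T.verts.filter (T.Desc · u) =
      insert u ((T.children u).biUnion fun c => T.verts.filter (T.Desc · c)) := by
    ext v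
    simp only [Finset.mem_filter, Finset.mem_insert, Finset.mem_biUnion]
    constructor
    · rintro ⟨hv, h⟩
      refine or_iff_not_imp_left.2 fun hne => ?_
      obtain ⟨c, hc, hd⟩ := hT.exists_child hv h hne
      exact ⟨c, hc, hv, hd⟩
    · rintro (rfl | ⟨c, hc, hv, hd⟩)
      · exact ⟨hu, Desc.refl T v⟩
      · exact ⟨hv, hd.trans (desc_of_mem_children hc)⟩
  unfold mass
  rw [hsplit, Finset.sum_insert, Finset.sum_biUnion]
  · intro c hc c' hc' hne
    refine Finset.disjoint_left.2 fun v hv hv' => hne ?_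
    exact hT.child_unique hc hc' (Finset.mem_filter.1 hv).2 (Finset.mem_filter.1 hv').2
  · simp only [Finset.mem_biUnion, Finset.mem_filter, not_exists, not_and]
    exact fun c hc _ => hT.not_desc_child hc

theorem mass_leaf (hT : T.IsTree) (y : ℕ → ℕ) {u : ℕ} (hu : u ∈ T.leaves) :
    T.mass y u = y u := by
  rw [hT.mass_eq y (mem_leaves.1 hu).1, (mem_leaves.1 hu).2, Finset.sum_empty, add_zero]

theorem mass_node (hT : T.IsTree) {y : ℕ → ℕ} (hy : y ∈ T.configs k) {u : ℕ}
    (hu : u ∈ T.verts) (hl : u ∉ T.leaves) :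
    T.mass y u = ∑ c ∈ T.children u, T.mass y c := by
  rw [hT.mass_eq y hu, hy.1 u hl, zero_add]

theorem mass_root (hT : T.IsTree) {y : ℕ → ℕ} (hy : y ∈ T.configs k) : T.mass y 0 = k := by
  classical
  rw [← sum_verts hy, mass, Finset.filter_true_of_mem hT.desc_root]

theorem apply_le (hT : T.IsTree) {y : ℕ → ℕ} (hy : y ∈ T.configs k) (u : ℕ) : y u ≤ k := by
  by_cases hu : u ∈ T.leaves
  · exact hT.mass_leaf y hu ▸ mass_le hy u
  · simp only [hy.1 u hu, Nat.zero_le]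

theorem leaves_nonempty (hT : T.IsTree) : T.leaves.Nonempty := by
  obtain ⟨f, hf, -⟩ := hT.exists_leaf_path (R := fun _ => True)
    (fun u hu hl _ => by
      obtain ⟨c, hc⟩ := Finset.nonempty_iff_ne_empty.2 fun h => hl (mem_leaves.2 ⟨hu, h⟩)
      exact ⟨c, hc, trivial⟩) hT.root_mem trivial
  exact ⟨f, hf⟩

/-- One climbs from `v` as long as the surplus of `w` over `y` is at least `τ`; where it first
drops, some other child has a deficit, and a deficit can be followed down to a leaf. -/
theorem exists_exchange (hT : T.IsTree) {w y : ℕ → ℕ} (hw : w ∈ T.configs k)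
    (hy : y ∈ T.configs k) {τ : ℕ} (hτ : 1 ≤ τ) {v : ℕ} (hv : v ∈ T.verts)
    (h : T.mass y v + τ ≤ T.mass w v) :
    ∃ f ∈ T.leaves, w f < y f ∧
      (∀ u ∈ T.up v f, T.mass y u + τ ≤ T.mass w u) ∧
      (∀ u ∈ T.up f v, T.mass w u < T.mass y u) := by
  obtain ⟨a, c, hc, hvc, ha, hup⟩ :=
    hT.exists_last_ancestor (P := fun u => T.mass y u + τ ≤ T.mass w u) hv h (by
      rw [hT.mass_root hw, hT.mass_root hy]; omega)
  have hva : T.Desc v a := hvc.trans (desc_of_mem_children hc)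
  obtain ⟨b, hb, hlt⟩ : ∃ b ∈ T.children a, T.mass w b < T.mass y b := by
    by_contra! hge
    refine ha ?_
    have hnode {z : ℕ → ℕ} (hz : z ∈ T.configs k) :=
      hT.mass_node hz (hT.desc_mem hv hva) (notMem_leaves_of_mem_children hc)
    rw [hnode hw, hnode hy, ← Finset.add_sum_erase _ _ hc,
      ← Finset.add_sum_erase (T.children a) (T.mass w) hc]
    have hrest := Finset.sum_le_sum fun b hb => hge b (Finset.mem_of_mem_erase (a := c) hb)
    have hsurplus := hup c hvc (Desc.refl T c)
    omega
  obtain ⟨f, hf, hfb, hdown⟩ := hT.exists_leaf_path (R := fun u => T.mass w u < T.mass y u)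
    (fun u hu hl hlt => by
      rw [hT.mass_node hw hu hl, hT.mass_node hy hu hl] at hlt
      exact Finset.exists_lt_of_sum_lt hlt) (mem_children.1 hb).2.1 hlt
  have hfa : T.Desc f a := hfb.trans (desc_of_mem_children hb)
  refine ⟨f, hf, ?_, fun u hu => ?_, fun u hu => ?_⟩
  rotate_left
  · obtain ⟨-, hvu, hfu⟩ := mem_up.1 hu
    exact hup u hvu (desc_sibling_of_not_desc hc hvc hfa hvu hfu)
  · obtain ⟨-, hfu, hvu⟩ := mem_up.1 hu
    exact hdown u hfu (desc_sibling_of_not_desc hb hfb hva hfu hvu)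
  simpa only [hT.mass_leaf _ hf] using hdown f (Desc.refl T f) hfb

end IsTree

end WTree

/-- The configuration `y` after one robot has moved from `a` to `b`. It is meaningful only if
`1 ≤ y a`, because of the truncated subtraction. -/
def transfer (y : ℕ → ℕ) (a b : ℕ) : ℕ → ℕ := y - Pi.single a 1 + Pi.single b 1

section Transfer

variable {y : ℕ → ℕ} {a b : ℕ}

theorem transfer_add_single (ha : 1 ≤ y a) :
    transfer y a b + Pi.single a 1 = y + Pi.single b 1 := by
  have hle : Pi.single a 1 ≤ y := by
    intro v
    rcases eq_or_ne v a with rfl | hv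
    · simpa only [Pi.single_eq_same]
    · simp only [Pi.single_eq_of_ne hv, Nat.zero_le]
  rw [transfer, add_right_comm, tsub_add_cancel_of_le hle]

theorem transfer_self (ha : 1 ≤ y a) : transfer y a a = y :=
  add_right_cancel (transfer_add_single ha)

theorem transfer_source (hab : a ≠ b) : transfer y a b a = y a - 1 := by
  simp [transfer, hab]

theorem transfer_target (hab : a ≠ b) : transfer y a b b = y b + 1 := by
  simp [transfer, hab.symm]

theorem transfer_of_ne {v : ℕ} (ha : v ≠ a) (hb : v ≠ b) : transfer y a b v = y v := by
  simp [transfer, ha, hb]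

end Transfer

namespace WTree

variable {T : WTree} {k : ℕ} {φ : ℝ → ℝ}

theorem single_mem_configs {l : ℕ} (hl : l ∈ T.leaves) (k : ℕ) :
    Pi.single l k ∈ T.configs k := by
  refine ⟨fun u hu => ?_, by rw [Finset.sum_pi_single', if_pos hl]⟩
  have hul : u ≠ l := by rintro rfl; exact hu hl
  rw [Pi.single_eq_of_ne hul]

theorem configs_finite (T : WTree) (k : ℕ) : (T.configs k).Finite := by
  refine Set.Finite.of_injOn (f := fun x (u : T.leaves) => x u) (fun x hx => ?_)
    (fun x hx y hy hxy => funext fun u => ?_) (Set.finite_Icc 0 fun _ => k)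
  · refine ⟨fun _ => Nat.zero_le _, fun u => ?_⟩
    rw [← hx.2]
    exact Finset.single_le_sum (f := x) (fun _ _ => Nat.zero_le _) u.2
  · by_cases hu : u ∈ T.leaves
    · exact congrFun hxy ⟨u, hu⟩
    · rw [hx.1 u hu, hy.1 u hu]

theorem transfer_mem_configs {y : ℕ → ℕ} {a b : ℕ} (ha : a ∈ T.leaves) (hb : b ∈ T.leaves)
    (hya : 1 ≤ y a) (hy : y ∈ T.configs k) : transfer y a b ∈ T.configs k := by
  refine ⟨fun u hu => ?_, ?_⟩
  · rw [transfer_of_ne (by rintro rfl; exact hu ha) (by rintro rfl; exact hu hb), hy.1 u hu]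
  · have h := congrArg (fun z => ∑ v ∈ T.leaves, z v) (transfer_add_single (b := b) hya)
    simp only [Pi.add_apply, Finset.sum_add_distrib, (single_mem_configs ha 1).2,
      (single_mem_configs hb 1).2, hy.2] at h
    omega

open Classical in
theorem mass_transfer_add {y : ℕ → ℕ} {a b : ℕ} (ha : a ∈ T.verts) (hb : b ∈ T.verts)
    (hya : 1 ≤ y a) (u : ℕ) :
    T.mass (transfer y a b) u + (if T.Desc a u then 1 else 0)
      = T.mass y u + (if T.Desc b u then 1 else 0) := by
  rw [← mass_single ha, ← mass_single hb, ← mass_add, ← mass_add, transfer_add_single hya]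

theorem one_le_mass {y : ℕ → ℕ} {a u : ℕ} (ha : a ∈ T.verts) (hya : 1 ≤ y a) (h : T.Desc a u) :
    1 ≤ T.mass y u := by
  classical
  exact hya.trans (Finset.single_le_sum (f := y) (fun _ _ => Nat.zero_le _)
    (Finset.mem_filter.2 ⟨ha, h⟩))

theorem sum_sub_transfer {y : ℕ → ℕ} {a b : ℕ} (ha : a ∈ T.verts) (hb : b ∈ T.verts)
    (hya : 1 ≤ y a) (F : ℕ → ℝ → ℝ) :
    ∑ u ∈ T.verts.erase 0, (F u (T.mass (transfer y a b) u) - F u (T.mass y u))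
      = ∑ u ∈ T.up b a, (F u (T.mass y u + 1) - F u (T.mass y u))
        - ∑ u ∈ T.up a b, (F u (T.mass y u) - F u (T.mass y u - 1)) := by
  classical
  rw [up, up, Finset.sum_filter, Finset.sum_filter, ← Finset.sum_sub_distrib]
  refine Finset.sum_congr rfl fun u _ => ?_
  have hm := congrArg (Nat.cast (R := ℝ)) (mass_transfer_add ha hb hya u)
  push_cast at hm
  rw [eq_sub_of_add_eq hm]
  by_cases hau : T.Desc a u <;> by_cases hbu : T.Desc b u <;> simp [hau, hbu]

theorem potential_transfer {y : ℕ → ℕ} {a b : ℕ} (ha : a ∈ T.verts) (hb : b ∈ T.verts)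
    (hya : 1 ≤ y a) (φ : ℝ → ℝ) :
    T.potential φ (transfer y a b) = T.potential φ y
      + ∑ u ∈ T.up b a, T.len u * (φ (T.mass y u + 1) - φ (T.mass y u))
      - ∑ u ∈ T.up a b, T.len u * (φ (T.mass y u) - φ (T.mass y u - 1)) := by
  have h := sum_sub_transfer ha hb hya fun u m => T.len u * φ m
  rw [Finset.sum_sub_distrib] at h
  simp only [mul_sub] at h ⊢
  exact eq_add_of_sub_eq' h |>.trans (add_sub_assoc _ _ _).symm

/-- The length of the edges between `a` and the path from `b` to the root, so that the distance
between `a` and `b` is `T.upLen a b + T.upLen b a`. -/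
noncomputable def upLen (T : WTree) (a b : ℕ) : ℝ := ∑ u ∈ T.up a b, T.len u

theorem OT_self (T : WTree) (x : ℕ → ℕ) : T.OT x x = 0 := by simp [OT]

theorem OT_transfer {y : ℕ → ℕ} {a b : ℕ} (ha : a ∈ T.verts) (hb : b ∈ T.verts)
    (hya : 1 ≤ y a) : T.OT y (transfer y a b) = T.upLen b a + T.upLen a b := by
  have h := sum_sub_transfer ha hb hya fun u m => T.len u * |(T.mass y u : ℝ) - m|
  simpa [upLen, OT] using h

/-- The increase of potential plus transport when `w` sends a robot from `l` to `f`. -/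
noncomputable def moveCost (T : WTree) (φ : ℝ → ℝ) (w : ℕ → ℕ) (l f : ℕ) : ℝ :=
  T.potential φ (transfer w l f) + T.OT w (transfer w l f) - T.potential φ w

theorem moveCost_eq {w : ℕ → ℕ} {l f : ℕ} (hl : l ∈ T.verts) (hf : f ∈ T.verts) (hw : 1 ≤ w l) :
    T.moveCost φ w l f = ∑ u ∈ T.up f l, T.len u * (φ (T.mass w u + 1) - φ (T.mass w u) + 1)
      - ∑ u ∈ T.up l f, T.len u * (φ (T.mass w u) - φ (T.mass w u - 1) - 1) := by
  simp only [moveCost, potential_transfer hl hf hw, OT_transfer hl hf hw, upLen, mul_add, mul_sub,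
    Finset.sum_add_distrib, Finset.sum_sub_distrib, mul_one]
  ring

namespace IsTree

theorem len_nonneg (hT : T.IsTree) {u : ℕ} (hu : u ∈ T.verts) : 0 ≤ T.len u := by
  rcases eq_or_ne u 0 with rfl | h
  exacts [hT.len_root.ge, (hT.len_pos u hu h).le]

theorem len_nonneg_of_mem_up (hT : T.IsTree) {a b u : ℕ} (hu : u ∈ T.up a b) : 0 ≤ T.len u :=
  hT.len_nonneg (mem_up.1 hu).1.2

theorem upLen_nonneg (hT : T.IsTree) (a b : ℕ) : 0 ≤ T.upLen a b :=
  Finset.sum_nonneg fun _ hu => hT.len_nonneg_of_mem_up hu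

theorem upLen_mono (hT : T.IsTree) {a b a' b' : ℕ} (h : T.up a b ⊆ T.up a' b') :
    T.upLen a b ≤ T.upLen a' b' :=
  Finset.sum_le_sum_of_subset_of_nonneg h fun _ hu _ => hT.len_nonneg_of_mem_up hu

theorem len_le_upLen (hT : T.IsTree) {l f : ℕ} (hl : l ∈ T.leaves) (hf : f ∈ T.verts)
    (hlf : f ≠ l) : T.len l ≤ T.upLen l f := by
  rcases eq_or_ne l 0 with rfl | h0
  · exact hT.len_root.trans_le (hT.upLen_nonneg _ _)
  · refine Finset.single_le_sum (f := T.len) (fun u hu => hT.len_nonneg_of_mem_up hu)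
      (mem_up.2 ⟨⟨h0, (mem_leaves.1 hl).1⟩, Desc.refl T l, fun h => hlf ?_⟩)
    exact hT.eq_of_desc_leaf hf hl h

theorem potential_nonneg (hT : T.IsTree) (hφ : ∀ m : ℕ, 0 ≤ φ m) (y : ℕ → ℕ) :
    0 ≤ T.potential φ y :=
  Finset.sum_nonneg fun _ hu => mul_nonneg (hT.len_nonneg (Finset.mem_of_mem_erase hu)) (hφ _)

theorem OT_nonneg (hT : T.IsTree) (x y : ℕ → ℕ) : 0 ≤ T.OT x y :=
  Finset.sum_nonneg fun _ hu =>
    mul_nonneg (hT.len_nonneg (Finset.mem_of_mem_erase hu)) (abs_nonneg _)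

theorem OT_triangle (hT : T.IsTree) (x y z : ℕ → ℕ) : T.OT x z ≤ T.OT x y + T.OT y z := by
  unfold OT
  rw [← Finset.sum_add_distrib]
  refine Finset.sum_le_sum fun u hu => ?_
  rw [← mul_add]
  exact mul_le_mul_of_nonneg_left (abs_sub_le _ _ _) (hT.len_nonneg (Finset.mem_of_mem_erase hu))

theorem eq_of_OT_eq_zero (hT : T.IsTree) {x y : ℕ → ℕ} (hx : x ∈ T.configs k)
    (hy : y ∈ T.configs k) (h : T.OT x y = 0) : x = y := by
  funext u
  by_cases hu : u ∈ T.leaves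
  swap
  · rw [hx.1 u hu, hy.1 u hu]
  rw [← hT.mass_leaf x hu, ← hT.mass_leaf y hu]
  rcases eq_or_ne u 0 with rfl | h0
  · rw [hT.mass_root hx, hT.mass_root hy]
  have huv := (mem_leaves.1 hu).1
  have hterm := (Finset.sum_eq_zero_iff_of_nonneg fun v hv =>
    mul_nonneg (hT.len_nonneg (Finset.mem_of_mem_erase hv)) (abs_nonneg _)).1 h u
      (Finset.mem_erase.2 ⟨h0, huv⟩)
  have hmass := (mul_eq_zero.1 hterm).resolve_left (hT.len_pos u huv h0).ne'
  exact_mod_cast sub_eq_zero.1 (abs_eq_zero.1 hmass)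

end IsTree

/-- No transport from `x` to another configuration pays off. -/
def Stable (T : WTree) (k : ℕ) (φ : ℝ → ℝ) (x : ℕ → ℕ) : Prop :=
  ∀ z ∈ T.configs k, T.potential φ x ≤ T.potential φ z + T.OT x z

/-- Every transport from `x` to another configuration makes a loss. Given the tie-breaking rule,
these are the configurations in which the greedy player rests. -/
def StrictlyStable (T : WTree) (k : ℕ) (φ : ℝ → ℝ) (x : ℕ → ℕ) : Prop :=
  ∀ z ∈ T.configs k, z ≠ x → T.potential φ x < T.potential φ z + T.OT x z

theorem StrictlyStable.stable {x : ℕ → ℕ} (h : T.StrictlyStable k φ x) : T.Stable k φ x := by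
  intro z hz
  rcases eq_or_ne z x with rfl | hzx
  · rw [OT_self, add_zero]
  · exact (h z hz hzx).le

theorem Stable.moveCost_nonneg {x : ℕ → ℕ} (h : T.Stable k φ x) (hx : x ∈ T.configs k) {l f : ℕ}
    (hl : l ∈ T.leaves) (hf : f ∈ T.leaves) (hxl : 1 ≤ x l) : 0 ≤ T.moveCost φ x l f :=
  sub_nonneg.2 (h _ (transfer_mem_configs hl hf hxl hx))

end WTree

/-- The function `φ` of the theorem for `k` robots. -/
noncomputable def phi (k : ℕ) : ℝ → ℝ := fun y => 20 * (k : ℝ) * y + 5 * y ^ 2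

theorem phi_add_one_sub (k : ℕ) (y : ℝ) : phi k (y + 1) - phi k y = 20 * k + 10 * y + 5 := by
  simp only [phi]; ring

theorem phi_sub_phi_sub_one (k : ℕ) (y : ℝ) :
    phi k y - phi k (y - 1) = 20 * k + 10 * y - 5 := by
  simp only [phi]; ring

theorem phi_zero (k : ℕ) : phi k 0 = 0 := by simp [phi]

theorem phi_nonneg (k m : ℕ) : 0 ≤ phi k m := by
  simp only [phi]; positivity

namespace WTree

variable {T : WTree} {k : ℕ}

namespace IsTree

/-- The moves of a robot of `w` from `l` to `f` and of a robot of `y` back from `f` to `l` are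
compared edge by edge; the numbers `a` and `b` bound the differences of `w` and `y` on the two
halves of the path. -/
theorem moveCost_le (hT : T.IsTree) {w y : ℕ → ℕ} {l f : ℕ}
    (hl : l ∈ T.verts) (hf : f ∈ T.verts) (hw : 1 ≤ w l) (hy : 1 ≤ y f) (a : ℕ → ℝ) (b : ℝ)
    (ha : ∀ u ∈ T.up l f, (T.mass y u : ℝ) + a u ≤ T.mass w u)
    (hb : ∀ u ∈ T.up f l, (T.mass w u : ℝ) ≤ T.mass y u + b) :
    T.moveCost (phi k) w l f ≤ T.potential (phi k) y - T.potential (phi k) (transfer y f l)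
      + (11 + 10 * b) * T.upLen f l + ∑ u ∈ T.up l f, T.len u * (11 - 10 * a u) := by
  rw [moveCost_eq hl hf hw, potential_transfer hf hl hy]
  simp only [phi_add_one_sub, phi_sub_phi_sub_one]
  have hdown : ∑ u ∈ T.up f l, T.len u * (20 * k + 10 * T.mass w u + 5 + 1)
      ≤ ∑ u ∈ T.up f l, T.len u * (20 * k + 10 * T.mass y u - 5)
        + (11 + 10 * b) * T.upLen f l := by
    rw [upLen, Finset.mul_sum, ← Finset.sum_add_distrib]
    refine Finset.sum_le_sum fun u hu => ?_
    linarith [mul_le_mul_of_nonneg_left (hb u hu) (hT.len_nonneg_of_mem_up hu)]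
  have hup : ∑ u ∈ T.up l f, T.len u * (20 * k + 10 * T.mass y u + 5)
      ≤ ∑ u ∈ T.up l f, T.len u * (20 * k + 10 * T.mass w u - 5 - 1)
        + ∑ u ∈ T.up l f, T.len u * (11 - 10 * a u) := by
    rw [← Finset.sum_add_distrib]
    refine Finset.sum_le_sum fun u hu => ?_
    linarith [mul_le_mul_of_nonneg_left (ha u hu) (hT.len_nonneg_of_mem_up hu)]
  linarith

/-- The increments of `phi k` on `0, …, k` lie between `20 k` and `30 k`, whence the ratio
`3 / 2`. -/
theorem upLen_le_of_gain_le (hT : T.IsTree) (hk : 2 ≤ k) {y : ℕ → ℕ} {l f : ℕ}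
    (hl : l ∈ T.verts) (hf : f ∈ T.verts) (hy : 1 ≤ y f)
    (hi : ∀ u ∈ T.up l f, T.mass y u + 1 ≤ k) {E : ℝ} (hE : 0 ≤ E)
    (h : T.potential (phi k) y - T.potential (phi k) (transfer y f l) ≤ E) :
    T.upLen f l ≤ 3 / 2 * T.upLen l f + E / 40 := by
  rw [potential_transfer hf hl hy] at h
  simp only [phi_add_one_sub, phi_sub_phi_sub_one] at h
  have hdown : 20 * (k : ℝ) * T.upLen f l
      ≤ ∑ u ∈ T.up f l, T.len u * (20 * k + 10 * T.mass y u - 5) := by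
    rw [upLen, Finset.mul_sum]
    refine Finset.sum_le_sum fun u hu => ?_
    have hm : (1 : ℝ) ≤ T.mass y u := by exact_mod_cast one_le_mass hf hy (mem_up.1 hu).2.1
    nlinarith [hT.len_nonneg_of_mem_up hu]
  have hup : ∑ u ∈ T.up l f, T.len u * (20 * k + 10 * T.mass y u + 5)
      ≤ 30 * (k : ℝ) * T.upLen l f := by
    rw [upLen, Finset.mul_sum]
    refine Finset.sum_le_sum fun u hu => ?_
    have hm : (T.mass y u : ℝ) + 1 ≤ k := by exact_mod_cast hi u hu
    nlinarith [hT.len_nonneg_of_mem_up hu]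
  have hk' : (2 : ℝ) ≤ k := by exact_mod_cast hk
  by_contra! hcon
  nlinarith [mul_le_mul_of_nonneg_right hk' hE,
    mul_lt_mul_of_pos_left hcon (show (0 : ℝ) < 20 * k by linarith)]

theorem exists_gain (hT : T.IsTree) (hk : 2 ≤ k) {x y : ℕ → ℕ} (hx : x ∈ T.configs k)
    (hy : y ∈ T.configs k) (hs : T.Stable k (phi k) x) {l : ℕ} (hl : l ∈ T.leaves)
    (h : y l + 2 ≤ x l) :
    ∃ j ∈ T.leaves, j ≠ l ∧ 1 ≤ y j ∧
      T.potential (phi k) (transfer y j l) + T.OT y (transfer y j l) + 4 * T.len l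
        ≤ T.potential (phi k) y := by
  have hlv := (mem_leaves.1 hl).1
  obtain ⟨j, hj, hlt, hup, hdown⟩ := hT.exists_exchange hx hy (τ := 2) (by norm_num) hlv
    (by rwa [hT.mass_leaf x hl, hT.mass_leaf y hl])
  have hjv := (mem_leaves.1 hj).1
  have hjl : j ≠ l := by rintro rfl; omega
  have hyj : 1 ≤ y j := by omega
  refine ⟨j, hj, hjl, hyj, ?_⟩
  rw [OT_transfer hjv hlv hyj]
  have hmove := hs.moveCost_nonneg hx hl hj (by omega)
  have hcompare := hT.moveCost_le (k := k) hlv hjv (show 1 ≤ x l by omega) hyj (fun _ => 2) (-1)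
    (fun u hu => by exact_mod_cast hup u hu)
    (fun u hu => le_add_neg_iff_add_le.2 (by exact_mod_cast hdown u hu))
  rw [← Finset.sum_mul, ← upLen] at hcompare
  set E := T.potential (phi k) y - T.potential (phi k) (transfer y j l)
  have hbranch := hT.upLen_le_of_gain_le hk hlv hjv hyj
    (fun u hu => by have := hup u hu; have := mass_le hx u; omega) (le_max_right E 0)
    (le_max_left E 0)
  have hlen := hT.len_le_upLen hl hjv hjl
  have := hT.upLen_nonneg l j
  have := hT.upLen_nonneg j l
  rcases le_total E 0 with hE | hE
  · rw [max_eq_right hE] at hbranch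
    linarith
  · rw [max_eq_left hE] at hbranch
    linarith

end IsTree

end WTree

theorem exists_le_and_pos_of_sum_le {ι : Type*} {s : Finset ι} {f g : ι → ℕ}
    (h : ∑ i ∈ s, f i ≤ ∑ i ∈ s, g i) (hg : 1 ≤ ∑ i ∈ s, g i) :
    ∃ i ∈ s, f i ≤ g i ∧ 1 ≤ g i := by
  by_contra! hlt
  obtain ⟨i, hi, hgi⟩ := Finset.exists_ne_zero_of_sum_ne_zero (Nat.one_le_iff_ne_zero.1 hg)
  refine (Finset.sum_lt_sum (fun j hj => ?_) ⟨i, hi, ?_⟩).not_ge h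
  · by_contra! hfg
    have := hlt j hj hfg.le
    omega
  · by_contra! hfg
    have := hlt i hi hfg
    omega

namespace WTree

variable {T : WTree} {k : ℕ} {φ : ℝ → ℝ}

namespace IsTree

theorem exists_leaf_of_mass_le (hT : T.IsTree) {w y : ℕ → ℕ} (hw : w ∈ T.configs k)
    (hy : y ∈ T.configs k) {b : ℕ} (hb : b ∈ T.verts) (hwb : T.mass w b ≤ T.mass y b)
    (hyb : 1 ≤ T.mass y b) :
    ∃ f ∈ T.leaves, T.Desc f b ∧ 1 ≤ y f ∧
      ∀ u, T.Desc f u → T.Desc u b → T.mass w u ≤ T.mass y u := by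
  obtain ⟨f, hf, hfb, hpath⟩ := hT.exists_leaf_path
    (R := fun u => T.mass w u ≤ T.mass y u ∧ 1 ≤ T.mass y u)
    (fun u hu hl h => by
      rw [hT.mass_node hw hu hl, hT.mass_node hy hu hl] at h
      exact exists_le_and_pos_of_sum_le h.1 h.2) hb ⟨hwb, hyb⟩
  refine ⟨f, hf, hfb, ?_, fun u hfu hub => (hpath u hfu hub).1⟩
  simpa only [hT.mass_leaf y hf] using (hpath f (Desc.refl T f) hfb).2

theorem exists_leaf_of_surplus_stops (hT : T.IsTree) {w y : ℕ → ℕ} (hw : w ∈ T.configs k)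
    (hy : y ∈ T.configs k) {l j : ℕ} (hl : l ∈ T.leaves) (hwl : y l + 1 ≤ w l) {v : ℕ}
    (hv : v ∈ T.up l j) (hlow : T.mass w v ≤ T.mass y v) :
    ∃ f ∈ T.leaves, f ≠ l ∧ 1 ≤ y f ∧ T.up l f ⊆ T.up l j ∧
      (∀ u ∈ T.up l f, T.mass y u + 1 ≤ T.mass w u) ∧
      ∀ u ∈ T.up f l, T.mass w u ≤ T.mass y u := by
  obtain ⟨f, hf, hlt, hup, hdown⟩ := hT.exists_exchange hw hy (τ := 1) le_rfl
    (mem_leaves.1 hl).1 (by rwa [hT.mass_leaf w hl, hT.mass_leaf y hl])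
  refine ⟨f, hf, by rintro rfl; omega, by omega, fun u hu => ?_, hup, fun u hu => (hdown u hu).le⟩
  obtain ⟨hv', hlv, hjv⟩ := mem_up.1 hv
  obtain ⟨hu', hlu, hfu⟩ := mem_up.1 hu
  have hfv : T.Desc f v := by
    by_contra hfv
    exact (hup v (mem_up.2 ⟨hv', hlv, hfv⟩)).not_gt (Nat.lt_succ_of_le hlow)
  refine mem_up.2 ⟨hu', hlu, fun hju => ?_⟩
  exact (hlu.total hlv).elim (fun h => hjv (hju.trans h)) fun h => hfu (hfv.trans h)

theorem exists_leaf_beside (hT : T.IsTree) {w y : ℕ → ℕ} (hw : w ∈ T.configs k)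
    (hy : y ∈ T.configs k) {l j q c : ℕ} (hc : c ∈ T.children q) (hlc : T.Desc l c)
    (hwc : T.mass y c + 1 ≤ T.mass w c) (hwq : T.mass w q ≤ T.mass y q + 1)
    (hj : j ∈ T.verts) (hyj : 1 ≤ y j) {d : ℕ} (hd : d ∈ T.children q) (hjd : T.Desc j d)
    (hdc : d ≠ c) :
    ∃ f ∈ T.leaves, f ≠ l ∧ 1 ≤ y f ∧ T.Desc f q ∧ ∀ u ∈ T.up f l, T.mass w u ≤ T.mass y u := by
  have hlq := hlc.trans (desc_of_mem_children hc)
  have hqv : q ∈ T.verts := hT.desc_mem hj (hjd.trans (desc_of_mem_children hd))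
  have hql := notMem_leaves_of_mem_children hc
  rw [hT.mass_node hw hqv hql, hT.mass_node hy hqv hql, ← Finset.add_sum_erase _ _ hc,
    ← Finset.add_sum_erase (T.children q) (T.mass y) hc] at hwq
  have hpos : 1 ≤ ∑ b ∈ (T.children q).erase c, T.mass y b :=
    (one_le_mass hj hyj hjd).trans (Finset.single_le_sum (f := T.mass y)
      (fun _ _ => Nat.zero_le _) (Finset.mem_erase.2 ⟨hdc, hd⟩))
  obtain ⟨b, hb, hwb, hyb⟩ :=
    exists_le_and_pos_of_sum_le (f := T.mass w) (by omega) hpos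
  obtain ⟨hbc, hb⟩ := Finset.mem_erase.1 hb
  obtain ⟨f, hf, hfb, hyf, hpath⟩ :=
    hT.exists_leaf_of_mass_le hw hy (mem_children.1 hb).2.1 hwb hyb
  refine ⟨f, hf, ?_, hyf, hfb.trans (desc_of_mem_children hb), fun u hu => ?_⟩
  · rintro rfl
    exact hbc (hT.child_unique hb hc hfb hlc)
  · obtain ⟨-, hfu, hlu⟩ := mem_up.1 hu
    exact hpath u hfu (desc_sibling_of_not_desc hb hfb hlq hfu hlu)

/-- If the surplus of `w` over `y` stops on the way from `l` to the path of `j`, then it is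
exchanged there. Otherwise let `q` be the vertex where the two paths meet: if the surplus at `q` is
at most one, then below another child of `q` there is a leaf `f`. -/
theorem exists_leaf_or_gap (hT : T.IsTree) {w y : ℕ → ℕ} (hw : w ∈ T.configs k)
    (hy : y ∈ T.configs k) {l j : ℕ} (hl : l ∈ T.leaves) (hj : j ∈ T.leaves) (hjl : j ≠ l)
    (hwl : y l + 1 ≤ w l) (hyj : 1 ≤ y j) :
    (∃ f ∈ T.leaves, f ≠ l ∧ 1 ≤ y f ∧ T.up l f ⊆ T.up l j ∧
      (∀ u ∈ T.up l f, T.mass y u + 1 ≤ T.mass w u) ∧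
      ∀ u ∈ T.up f l, T.mass w u ≤ T.mass y u) ∨
    ∃ q, T.Desc l q ∧ T.up l q ⊆ T.up l j ∧ T.mass y q + 2 ≤ T.mass w q ∧
      ∀ u ∈ T.up l q, T.mass y u + 1 ≤ T.mass w u := by
  have hlv := (mem_leaves.1 hl).1
  have hjv := (mem_leaves.1 hj).1
  by_cases hsurplus : ∀ u ∈ T.up l j, T.mass y u + 1 ≤ T.mass w u
  swap
  · push Not at hsurplus
    obtain ⟨v, hv, hlow⟩ := hsurplus
    exact Or.inl (hT.exists_leaf_of_surplus_stops hw hy hl hwl hv (Nat.le_of_lt_succ hlow))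
  obtain ⟨q, c, hc, hlc, hjq, hpath⟩ := hT.exists_last_ancestor (P := fun u => ¬ T.Desc j u) hlv
    (fun h => hjl (hT.eq_of_desc_leaf hjv hl h)) (not_not.2 (hT.desc_root j hjv))
  rw [not_not] at hjq
  obtain ⟨hc0, hcv, -⟩ := mem_children.1 hc
  have hsub {p : ℕ} (hp : T.Desc p q) : T.up l p ⊆ T.up l j := fun u hu => by
    obtain ⟨hu', hlu, hpu⟩ := mem_up.1 hu
    exact mem_up.2 ⟨hu', hlu, hpath u hlu (desc_sibling_of_not_desc hc hlc hp hlu hpu)⟩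
  by_cases hgap : T.mass y q + 2 ≤ T.mass w q
  · exact Or.inr ⟨q, hlc.trans (desc_of_mem_children hc), hsub (Desc.refl T q), hgap,
      fun u hu => hsurplus u (hsub (Desc.refl T q) hu)⟩
  obtain ⟨d, hd, hjd⟩ := hT.exists_child hjv hjq
    (by rintro rfl; exact notMem_leaves_of_mem_children hc hj)
  have hjc : ¬ T.Desc j c := hpath c hlc (Desc.refl T c)
  obtain ⟨f, hf, hfl, hyf, hfq, hdown⟩ := hT.exists_leaf_beside hw hy hc hlc
    (hsurplus c (mem_up.2 ⟨⟨hc0, hcv⟩, hlc, hjc⟩)) (by omega) hjv hyj hd hjd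
    (by rintro rfl; exact hjc hjd)
  exact Or.inl ⟨f, hf, hfl, hyf, hsub hfq, fun u hu => hsurplus u (hsub hfq hu), hdown⟩

open Classical in
theorem sum_up_gap_le (hT : T.IsTree) (l f q : ℕ) :
    ∑ u ∈ T.up l f, T.len u * (25 / 2 - 10 * if T.Desc q u then (2 : ℝ) else 1)
      ≤ 5 / 2 * T.upLen l q := by
  calc _ ≤ ∑ u ∈ T.up l f with ¬ T.Desc q u, 5 / 2 * T.len u := by
        rw [Finset.sum_filter]
        refine Finset.sum_le_sum fun u hu => ?_
        have := hT.len_nonneg_of_mem_up hu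
        by_cases hqu : T.Desc q u <;>
          simp only [hqu, if_true, if_false, not_true, not_false_iff] <;> linarith
    _ ≤ 5 / 2 * T.upLen l q := by
        rw [upLen, Finset.mul_sum]
        refine Finset.sum_le_sum_of_subset_of_nonneg (fun u hu => ?_) fun u hu _ =>
          mul_nonneg (by norm_num) (hT.len_nonneg_of_mem_up hu)
        obtain ⟨hu, hqu⟩ := Finset.mem_filter.1 hu
        obtain ⟨huv, hlu, -⟩ := mem_up.1 hu
        exact mem_up.2 ⟨huv, hlu, hqu⟩

theorem exists_cheap_move_of_gap (hT : T.IsTree) (hk : 2 ≤ k) {w y : ℕ → ℕ}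
    (hw : w ∈ T.configs k) (hy : y ∈ T.configs k) {l q : ℕ} (hl : l ∈ T.leaves)
    (hwl : y l + 1 ≤ w l) (hlq : T.Desc l q) (hq : T.mass y q + 2 ≤ T.mass w q)
    (hlow : ∀ u ∈ T.up l q, T.mass y u + 1 ≤ T.mass w u) {E : ℝ} (hE : 0 ≤ E)
    (hgain : ∀ f ∈ T.leaves, f ≠ l → 1 ≤ y f →
      T.potential (phi k) y - T.potential (phi k) (transfer y f l) ≤ E) :
    ∃ f ∈ T.leaves, f ≠ l ∧ T.moveCost (phi k) w l f ≤ 41 / 40 * E + 5 / 2 * T.upLen l q := by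
  classical
  have hlv := (mem_leaves.1 hl).1
  obtain ⟨f, hf, hlt, hup, hdown⟩ := hT.exists_exchange hw hy (τ := 2) (by norm_num)
    (hT.desc_mem hlv hlq) hq
  have hfv := (mem_leaves.1 hf).1
  have hfl : f ≠ l := by rintro rfl; omega
  have hyf : 1 ≤ y f := by omega
  have hsurplus : ∀ u ∈ T.up l f,
      T.mass y u + (if T.Desc q u then 2 else 1) ≤ T.mass w u := fun u hu => by
    obtain ⟨huv, hlu, hfu⟩ := mem_up.1 hu
    split_ifs with hqu
    exacts [hup u (mem_up.2 ⟨huv, hqu, hfu⟩), hlow u (mem_up.2 ⟨huv, hlu, hqu⟩)]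
  have hdeficit : ∀ u ∈ T.up f l, T.mass w u < T.mass y u := fun u hu => by
    obtain ⟨huv, hfu, hlu⟩ := mem_up.1 hu
    exact hdown u (mem_up.2 ⟨huv, hfu, fun hqu => hlu (hlq.trans hqu)⟩)
  have hcompare := hT.moveCost_le (k := k) hlv hfv (show 1 ≤ w l by omega) hyf
    (fun u => if T.Desc q u then 2 else 1) (-1) (fun u hu => by exact_mod_cast hsurplus u hu)
    (fun u hu => le_add_neg_iff_add_le.2 (by exact_mod_cast hdeficit u hu))
  have hbranch := hT.upLen_le_of_gain_le hk hlv hfv hyf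
    (fun u hu => (show T.mass y u + 1 ≤ T.mass w u by
      have := hsurplus u hu
      split_ifs at this <;> omega).trans (mass_le hw u)) hE (hgain f hf hfl hyf)
  have hsum := hT.sum_up_gap_le l f q
  refine ⟨f, hf, hfl, ?_⟩
  have hsplit : ∑ u ∈ T.up l f, T.len u * (25 / 2 - 10 * if T.Desc q u then (2 : ℝ) else 1)
      = ∑ u ∈ T.up l f, T.len u * (11 - 10 * if T.Desc q u then (2 : ℝ) else 1)
        + 3 / 2 * T.upLen l f := by
    rw [upLen, Finset.mul_sum, ← Finset.sum_add_distrib]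
    exact Finset.sum_congr rfl fun u _ => by ring
  linarith [hgain f hf hfl hyf]

theorem moveCost_le_of_surplus (hT : T.IsTree) (hk : 2 ≤ k) {w y : ℕ → ℕ}
    (hw : w ∈ T.configs k) {l f : ℕ} (hl : l ∈ T.verts) (hf : f ∈ T.verts) (hwl : 1 ≤ w l)
    (hyf : 1 ≤ y f) (hup : ∀ u ∈ T.up l f, T.mass y u + 1 ≤ T.mass w u)
    (hdown : ∀ u ∈ T.up f l, T.mass w u ≤ T.mass y u) {E : ℝ} (hE : 0 ≤ E)
    (hgain : T.potential (phi k) y - T.potential (phi k) (transfer y f l) ≤ E) :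
    T.moveCost (phi k) w l f ≤ 51 / 40 * E + 35 / 2 * T.upLen l f := by
  have hcompare := hT.moveCost_le (k := k) hl hf hwl hyf (fun _ => 1) 0
    (fun u hu => by exact_mod_cast hup u hu)
    (fun u hu => by rw [add_zero]; exact_mod_cast hdown u hu)
  rw [← Finset.sum_mul, ← upLen] at hcompare
  have hbranch := hT.upLen_le_of_gain_le hk hl hf hyf
    (fun u hu => (hup u hu).trans (mass_le hw u)) hE hgain
  linarith

theorem exists_cheap_last_move (hT : T.IsTree) (hk : 2 ≤ k) {w y : ℕ → ℕ}
    (hw : w ∈ T.configs k) (hy : y ∈ T.configs k) {l j : ℕ} (hl : l ∈ T.leaves)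
    (hj : j ∈ T.leaves) (hjl : j ≠ l) (hwl : y l + 1 ≤ w l) (hyj : 1 ≤ y j)
    {E : ℝ} (hE : T.upLen l j ≤ E)
    (hgain : ∀ f ∈ T.leaves, f ≠ l → 1 ≤ y f →
      T.potential (phi k) y - T.potential (phi k) (transfer y f l) ≤ E) :
    ∃ f ∈ T.leaves, f ≠ l ∧ T.moveCost (phi k) w l f ≤ 19 * E := by
  have hE0 : 0 ≤ E := (hT.upLen_nonneg l j).trans hE
  rcases hT.exists_leaf_or_gap hw hy hl hj hjl hwl hyj with
    ⟨f, hf, hfl, hyf, hsub, hup, hdown⟩ | ⟨q, hlq, hsub, hq, hlow⟩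
  · refine ⟨f, hf, hfl, ?_⟩
    have hcost := hT.moveCost_le_of_surplus hk hw (mem_leaves.1 hl).1 (mem_leaves.1 hf).1
      (show 1 ≤ w l by omega) hyf hup hdown hE0 (hgain f hf hfl hyf)
    linarith [hT.upLen_mono hsub]
  · obtain ⟨f, hf, hfl, hcost⟩ :=
      hT.exists_cheap_move_of_gap hk hw hy hl hwl hlq hq hlow hE0 hgain
    exact ⟨f, hf, hfl, by linarith [hT.upLen_mono hsub]⟩

end IsTree

/-- The leaf `l` attracts robots: a configuration without robots on `l` gains, even after paying for
the transport, by sending a robot to `l`. -/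
def Attracts (T : WTree) (k : ℕ) (φ : ℝ → ℝ) (l : ℕ) : Prop :=
  ∀ y ∈ T.configs k, y l = 0 → ∃ j ∈ T.leaves, j ≠ l ∧ 1 ≤ y j ∧
    T.potential φ (transfer y j l) + T.OT y (transfer y j l) < T.potential φ y

/-- `z` minimizes the potential among the configurations with at most `n` robots on `l`. The
differences of these minima for consecutive `n` pay for evacuating `l` robot by robot. -/
structure IsCappedMin (T : WTree) (k : ℕ) (φ : ℝ → ℝ) (l n : ℕ) (z : ℕ → ℕ) : Prop where
  mem : z ∈ T.configs k
  le : z l ≤ n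
  min : ∀ z' ∈ T.configs k, z' l ≤ n → T.potential φ z ≤ T.potential φ z'

namespace IsCappedMin

theorem antitone {l m n : ℕ} {y z : ℕ → ℕ} (hy : T.IsCappedMin k φ l m y)
    (hz : T.IsCappedMin k φ l n z) (hmn : m ≤ n) : T.potential φ z ≤ T.potential φ y :=
  hz.min y hy.mem (hy.le.trans hmn)

theorem le_transfer {l n : ℕ} {y z : ℕ → ℕ} (hy : T.IsCappedMin k φ l n y)
    (hz : T.IsCappedMin k φ l (n + 1) z) (hl : l ∈ T.leaves) {f : ℕ} (hf : f ∈ T.leaves)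
    (hfl : f ≠ l) (hyf : 1 ≤ y f) : T.potential φ z ≤ T.potential φ (transfer y f l) :=
  hz.min _ (transfer_mem_configs hf hl hyf hy.mem) (by
    rw [transfer_target hfl]; exact Nat.succ_le_succ hy.le)

end IsCappedMin

theorem exists_isCappedMin {y : ℕ → ℕ} (hy : y ∈ T.configs k) {l : ℕ} (hyl : y l = 0)
    (φ : ℝ → ℝ) (n : ℕ) : ∃ z, T.IsCappedMin k φ l n z := by
  obtain ⟨z, ⟨hz, hzn⟩, hmin⟩ := Set.exists_min_image {z | z ∈ T.configs k ∧ z l ≤ n}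
    (T.potential φ) ((T.configs_finite k).subset fun _ h => h.1) ⟨y, hy, by omega⟩
  exact ⟨z, hz, hzn, fun z' hz' hn => hmin z' ⟨hz', hn⟩⟩

namespace IsTree

theorem potential_add_OT_transfer_le (hT : T.IsTree) (φ : ℝ → ℝ) (x w : ℕ → ℕ) (l f : ℕ) :
    T.potential φ (transfer w l f) + T.OT x (transfer w l f)
      ≤ T.potential φ w + T.OT x w + T.moveCost φ w l f := by
  rw [moveCost]
  linarith [hT.OT_triangle x w (transfer w l f)]

theorem exists_evacuation_to_one (hT : T.IsTree) (hk : 2 ≤ k) {l : ℕ} (hl : l ∈ T.leaves)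
    {Y : ℕ → ℕ → ℕ} (hY : ∀ n, T.IsCappedMin k (phi k) l n (Y n)) (x : ℕ → ℕ) (n : ℕ)
    {w : ℕ → ℕ} (hw : w ∈ T.configs k) (hwl : w l = n + 1) :
    ∃ w' ∈ T.configs k, w' l = 1 ∧
      T.potential (phi k) w' + T.OT x w' ≤ T.potential (phi k) w + T.OT x w
        + 41 / 40 * (T.potential (phi k) (Y 0) - T.potential (phi k) (Y n)) := by
  induction n generalizing w with
  | zero => exact ⟨w, hw, hwl, by linarith⟩
  | succ n ih =>
    have hYl := (hY n).le
    have hl0 : T.upLen l l = 0 := Finset.sum_eq_zero fun u hu =>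
      absurd (mem_up.1 hu).2.1 (mem_up.1 hu).2.2
    obtain ⟨f, hf, hfl, hmove⟩ := hT.exists_cheap_move_of_gap hk hw (hY n).mem hl (by omega)
      (Desc.refl T l) (by rw [hT.mass_leaf w hl, hT.mass_leaf (Y n) hl]; omega)
      (fun u hu => absurd (mem_up.1 hu).2.1 (mem_up.1 hu).2.2)
      (sub_nonneg.2 ((hY n).antitone (hY (n + 1)) n.le_succ))
      (fun f hf hfl hyf => sub_le_sub_left ((hY n).le_transfer (hY (n + 1)) hl hf hfl hyf) _)
    obtain ⟨w', hw', hw'l, hle⟩ := ih (transfer_mem_configs hl hf (by omega) hw)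
      (by rw [transfer_source hfl.symm]; omega)
    refine ⟨w', hw', hw'l, ?_⟩
    rw [hl0] at hmove
    linarith [hT.potential_add_OT_transfer_le (phi k) x w l f]

/-- The constant is at least `41 / 40` for the robots that leave `l` before the last one, plus `19`
for the last one. -/
theorem exists_evacuation (hT : T.IsTree) (hk : 2 ≤ k) {x y : ℕ → ℕ}
    (hx : x ∈ T.configs k) (hy : y ∈ T.configs k) {l : ℕ} (hl : l ∈ T.leaves) (hyl : y l = 0)
    (hA : T.Attracts k (phi k) l) :
    ∃ w ∈ T.configs k, w l = 0 ∧ ∃ z ∈ T.configs k,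
      T.potential (phi k) w + T.OT x w
        ≤ T.potential (phi k) x + 21 * (T.potential (phi k) y - T.potential (phi k) z) := by
  choose Y hY using exists_isCappedMin hy hyl (phi k)
  have hY0y := (hY 0).min y hy hyl.le
  obtain hxl | ⟨n, hxl⟩ : x l = 0 ∨ ∃ n, x l = n + 1 := by cases x l <;> simp
  · exact ⟨x, hx, hxl, y, hy, by rw [OT_self]; linarith⟩
  obtain ⟨w, hw, hwl, hle⟩ := hT.exists_evacuation_to_one hk hl hY x n hx hxl
  have hnk : n + 1 ≤ k := hxl ▸ hT.apply_le hx l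
  have hY0l : Y 0 l = 0 := Nat.le_zero.1 (hY 0).le
  have hY0 := (hY 0).antitone (hY k) (Nat.zero_le k)
  have hYn := (hY n).antitone (hY k) (by omega)
  have hgain : ∀ f ∈ T.leaves, f ≠ l → 1 ≤ Y 0 f →
      T.potential (phi k) (Y 0) - T.potential (phi k) (transfer (Y 0) f l)
        ≤ T.potential (phi k) (Y 0) - T.potential (phi k) (Y k) := fun f hf hfl hyf =>
    sub_le_sub_left (((hY 1).antitone (hY k) (by omega)).trans
      ((hY 0).le_transfer (hY 1) hl hf hfl hyf)) _
  obtain ⟨j, hj, hjl, hyj, hattract⟩ := hA (Y 0) (hY 0).mem hY0l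
  rw [OT_transfer (mem_leaves.1 hj).1 (mem_leaves.1 hl).1 hyj] at hattract
  obtain ⟨f, hf, hfl, hmove⟩ := hT.exists_cheap_last_move hk hw (hY 0).mem hl hj hjl (by omega) hyj
    (by linarith [hgain j hj hjl hyj, hT.upLen_nonneg j l]) hgain
  refine ⟨transfer w l f, transfer_mem_configs hl hf (by omega) hw, ?_, Y k, (hY k).mem, ?_⟩
  · rw [transfer_source hfl.symm, hwl]
  · rw [OT_self, add_zero] at hle
    linarith [hT.potential_add_OT_transfer_le (phi k) x w l f]

end IsTree

end WTree

theorem phi_transfer_add_abs (k : ℕ) {y : ℕ → ℕ} {a b : ℕ} (hab : a ≠ b) (hya : 1 ≤ y a) (v : ℕ) :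
    phi k (transfer y a b v) + |(y v : ℝ) - transfer y a b v|
      = phi k (y v) + (if v = b then 20 * k + 10 * (y b : ℝ) + 6 else 0)
        - (if v = a then 20 * k + 10 * (y a : ℝ) - 6 else 0) := by
  rcases eq_or_ne v a with rfl | hva
  · have := phi_sub_phi_sub_one k (y v)
    rw [transfer_source hab, if_neg hab, if_pos rfl, Nat.cast_sub hya, Nat.cast_one,
      sub_sub_cancel, abs_one]
    linarith
  · rcases eq_or_ne v b with rfl | hvb
    · have := phi_add_one_sub k (y v)
      rw [transfer_target hab, if_pos rfl, if_neg hva, Nat.cast_succ, sub_add_cancel_left, abs_neg,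
        abs_one]
      linarith
    · rw [transfer_of_ne hva hvb, if_neg hva, if_neg hvb, sub_self, abs_zero]
      ring

namespace WTree

variable {T : WTree} {k : ℕ}

/-! ### Elongations -/

theorem IsTree.elongate (hT : T.IsTree) {l : ℕ} (hl : l ∈ T.verts) (hl0 : l ≠ 0) {s : ℝ}
    (hs : 0 ≤ s) : (T.elongate l s).IsTree where
  __ := hT
  len_pos u hu hu0 := by
    rcases eq_or_ne u l with rfl | h
    · simpa only [WTree.elongate, Function.update_self] using
        add_pos_of_pos_of_nonneg (hT.len_pos u hu hu0) hs
    · simpa only [WTree.elongate, Function.update_of_ne h] using hT.len_pos u hu hu0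
  len_root := by simpa only [WTree.elongate, Function.update_of_ne hl0.symm] using hT.len_root
  off_verts u hu := by
    have h : u ≠ l := fun h => hu (h ▸ hl)
    simpa only [WTree.elongate, Function.update_of_ne h] using hT.off_verts u hu

theorem IsSimpleTree.elongate (hT : T.IsSimpleTree) {l : ℕ} (hl : l ∈ T.verts) (hl0 : l ≠ 0)
    {s : ℝ} (hs : 0 ≤ s) : (T.elongate l s).IsSimpleTree :=
  (hT.isTree.elongate hl hl0 hs).isSimpleTree hT.simple

theorem sum_elongate {l : ℕ} (hl : l ∈ T.verts) (hl0 : l ≠ 0) (s : ℝ) (G : ℕ → ℝ) :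
    ∑ u ∈ T.verts.erase 0, (T.elongate l s).len u * G u
      = ∑ u ∈ T.verts.erase 0, T.len u * G u + s * G l := by
  have hmem : l ∈ T.verts.erase 0 := Finset.mem_erase.2 ⟨hl0, hl⟩
  have hne : ∀ u ∈ (T.verts.erase 0).erase l, (T.elongate l s).len u * G u = T.len u * G u :=
    fun u hu => by simp only [elongate, Function.update_of_ne (Finset.ne_of_mem_erase hu)]
  rw [← Finset.add_sum_erase _ _ hmem, ← Finset.add_sum_erase _ (fun u => T.len u * G u) hmem,
    Finset.sum_congr rfl hne]
  simp only [elongate, Function.update_self]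
  ring

theorem IsTree.potential_elongate (hT : T.IsTree) {l : ℕ} (hl : l ∈ T.leaves) (hl0 : l ≠ 0)
    (s : ℝ) (φ : ℝ → ℝ) (y : ℕ → ℕ) :
    (T.elongate l s).potential φ y = T.potential φ y + s * φ (y l) := by
  rw [← hT.mass_leaf y hl]
  exact sum_elongate (mem_leaves.1 hl).1 hl0 s fun u => φ (T.mass y u)

theorem IsTree.OT_elongate (hT : T.IsTree) {l : ℕ} (hl : l ∈ T.leaves) (hl0 : l ≠ 0) (s : ℝ)
    (x y : ℕ → ℕ) : (T.elongate l s).OT x y = T.OT x y + s * |(x l : ℝ) - y l| := by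
  rw [← hT.mass_leaf x hl, ← hT.mass_leaf y hl]
  exact sum_elongate (mem_leaves.1 hl).1 hl0 s fun u => |(T.mass x u : ℝ) - T.mass y u|

/-- An old edge pays for the extra transport, since `phi k` grows by at least one per robot. The
elongated leaf itself attracts robots because the stable configuration `x` has two robots there. -/
theorem IsTree.attracts_elongate (hT : T.IsTree) (hk : 2 ≤ k) {x : ℕ → ℕ} (hx : x ∈ T.configs k)
    {l : ℕ} (hl : l ∈ T.leaves) (hl0 : l ≠ 0) (hxl : 2 ≤ x l) {s : ℝ} (hs : 0 ≤ s)
    (hst : (T.elongate l s).Stable k (phi k) x) (hA : ∀ i ∈ T.leaves, T.Attracts k (phi k) i) :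
    ∀ i ∈ T.leaves, (T.elongate l s).Attracts k (phi k) i := by
  intro i hi y hy hyi
  have hlv := (mem_leaves.1 hl).1
  have hT' := hT.elongate hlv hl0 hs
  rcases eq_or_ne i l with rfl | hil
  · obtain ⟨j, hj, hji, hyj, hgain⟩ := hT'.exists_gain hk (x := x) hx hy hst hi (by omega)
    exact ⟨j, hj, hji, hyj, by linarith [hT'.len_pos i hlv hl0]⟩
  · obtain ⟨j, hj, hji, hyj, hgain⟩ := hA i hi y hy hyi
    refine ⟨j, hj, hji, hyj, ?_⟩
    have hpay : phi k (transfer y j i l) + |(y l : ℝ) - transfer y j i l| ≤ phi k (y l) := by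
      have : (2 : ℝ) ≤ k := by exact_mod_cast hk
      have : (0 : ℝ) ≤ y j := Nat.cast_nonneg _
      rw [phi_transfer_add_abs k hji hyj, if_neg hil.symm]
      split_ifs <;> linarith
    rw [hT.potential_elongate hl hl0, hT.potential_elongate hl hl0, hT.OT_elongate hl hl0]
    linarith [mul_le_mul_of_nonneg_left hpay hs]

end WTree

/-! ### Forks -/

/-- The configuration before a fork of `l` into `S`: the robots of the new leaves are gathered at
`l`. -/
def gather (l : ℕ) (S : Finset ℕ) (y : ℕ → ℕ) : ℕ → ℕ :=
  fun v => if v = l then y l + ∑ s ∈ S, y s else if v ∈ S then 0 else y v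

section Gather

variable {l : ℕ} {S : Finset ℕ} {y : ℕ → ℕ}

theorem gather_of_ne {v : ℕ} (hvl : v ≠ l) (hvS : v ∉ S) : gather l S y v = y v := by
  simp only [gather, if_neg hvl, if_neg hvS]

theorem gather_self : gather l S y l = y l + ∑ s ∈ S, y s := if_pos rfl

theorem gather_of_mem {v : ℕ} (hvl : v ≠ l) (hvS : v ∈ S) : gather l S y v = 0 := by
  simp only [gather, if_neg hvl, if_pos hvS]

theorem gather_add (y z : ℕ → ℕ) : gather l S (y + z) = gather l S y + gather l S z := by
  funext v
  simp only [gather, Pi.add_apply, Finset.sum_add_distrib]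
  split_ifs <;> omega

theorem gather_single (hlS : l ∉ S) (c : ℕ) :
    gather l S (Pi.single c 1) = Pi.single (if c ∈ S then l else c) 1 := by
  funext v
  rcases eq_or_ne v l with rfl | hvl
  · rw [gather_self, Finset.sum_pi_single']
    rcases eq_or_ne v c with rfl | hvc
    · simp [hlS]
    · by_cases hc : c ∈ S <;> simp [hc, hvc]
  · by_cases hvS : v ∈ S
    · rw [gather_of_mem hvl hvS, Pi.single_eq_of_ne]
      split_ifs with hc
      exacts [hvl, fun h => hc (h ▸ hvS)]
    · rw [gather_of_ne hvl hvS]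
      split_ifs with hc
      · rw [Pi.single_eq_of_ne hvl, Pi.single_eq_of_ne]
        exact fun h => hvS (h ▸ hc)
      · rfl

theorem gather_transfer (hlS : l ∉ S) {a : ℕ} (hya : 1 ≤ y a) (b : ℕ) :
    gather l S (transfer y a b)
      = transfer (gather l S y) (if a ∈ S then l else a) (if b ∈ S then l else b) := by
  have hmove := congrArg (gather l S) (transfer_add_single (b := b) hya)
  rw [gather_add, gather_add, gather_single hlS, gather_single hlS] at hmove
  have hpos : 1 ≤ gather l S y (if a ∈ S then l else a) := by
    split_ifs with ha
    · rw [gather_self]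
      exact (hya.trans (Finset.single_le_sum (fun _ _ => Nat.zero_le _) ha)).trans
        (Nat.le_add_left _ _)
    · rcases eq_or_ne a l with rfl | hal
      · exact hya.trans (gather_self.symm ▸ Nat.le_add_right _ _)
      · rwa [gather_of_ne hal ha]
  exact add_right_cancel (hmove.trans (transfer_add_single hpos).symm)

end Gather

namespace WTree

section Fork

variable {T : WTree} {k : ℕ} {l : ℕ} {S : Finset ℕ} {δ : ℝ}

theorem mem_verts_fork {v : ℕ} : v ∈ (T.fork l S δ).verts ↔ v ∈ T.verts ∨ v ∈ S :=
  Finset.mem_union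

theorem parent_fork_old (hS : Disjoint S T.verts) {v : ℕ} (hv : v ∈ T.verts) :
    (T.fork l S δ).parent v = T.parent v :=
  if_neg (Finset.disjoint_right.1 hS hv)

theorem parent_fork_new {s : ℕ} (hs : s ∈ S) : (T.fork l S δ).parent s = l := if_pos hs

theorem notMem_of_mem_leaves (hS : Disjoint S T.verts) {v : ℕ} (hv : v ∈ T.leaves) : v ∉ S :=
  Finset.disjoint_right.1 hS (mem_leaves.1 hv).1

theorem children_fork_old (hS : Disjoint S T.verts) {u : ℕ} (hul : u ≠ l) :
    (T.fork l S δ).children u = T.children u := by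
  ext c
  rw [mem_children, mem_children, mem_verts_fork]
  constructor
  · rintro ⟨hc0, hc | hc, hp⟩
    · exact ⟨hc0, hc, parent_fork_old hS hc ▸ hp⟩
    · exact absurd (hp.symm.trans (parent_fork_new hc)) hul
  · rintro ⟨hc0, hc, hp⟩
    exact ⟨hc0, Or.inl hc, (parent_fork_old hS hc).trans hp⟩

namespace IsTree

theorem fork (hT : T.IsTree) (hS : Disjoint S T.verts) (hl : l ∈ T.verts) (hδ : 0 < δ) :
    (T.fork l S δ).IsTree := by
  have h0S : (0 : ℕ) ∉ S := Finset.disjoint_right.1 hS hT.root_mem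
  have hold : ∀ v ∈ T.verts, (T.fork l S δ).Desc v 0 := fun v hv => by
    induction hv using hT.root_induction with
    | root => exact Desc.refl _ 0
    | step v hv _ ih =>
      exact desc_iff.2 (Or.inr (by rwa [parent_fork_old hS hv]))
  refine ⟨mem_verts_fork.2 (Or.inl hT.root_mem), fun u hu => ?_, fun u hu => ?_, fun u hu hu0 => ?_,
    (parent_fork_old hS hT.root_mem).trans hT.parent_root, (if_neg h0S).trans hT.len_root,
    fun u hu => ?_⟩
  · rw [mem_verts_fork]
    rcases mem_verts_fork.1 hu with hu | hu
    · exact Or.inl (parent_fork_old hS hu ▸ hT.parent_mem u hu)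
    · exact Or.inl (parent_fork_new hu ▸ hl)
  · rcases mem_verts_fork.1 hu with hu | hu
    · exact hold u hu
    · exact desc_iff.2 (Or.inr (by rw [parent_fork_new hu]; exact hold l hl))
  · rcases mem_verts_fork.1 hu with hu | hu
    · exact (hT.len_pos u hu hu0).trans_eq (if_neg (Finset.disjoint_right.1 hS hu)).symm
    · exact hδ.trans_eq (if_pos hu).symm
  · rw [mem_verts_fork, not_or] at hu
    exact ⟨(if_neg hu.2).trans (hT.off_verts u hu.1).1, (if_neg hu.2).trans (hT.off_verts u hu.1).2⟩

theorem children_fork_self (hT : T.IsTree) (hS : Disjoint S T.verts) (hl : l ∈ T.leaves) :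
    (T.fork l S δ).children l = S := by
  ext c
  rw [mem_children, mem_verts_fork]
  constructor
  · rintro ⟨hc0, hc | hc, hp⟩
    · exact absurd hl (notMem_leaves_of_mem_children
        (mem_children.2 ⟨hc0, hc, parent_fork_old hS hc ▸ hp⟩))
    · exact hc
  · exact fun hc => ⟨fun h0 => Finset.disjoint_left.1 hS hc (h0 ▸ hT.root_mem), Or.inr hc,
      parent_fork_new hc⟩

theorem children_fork_new (hT : T.IsTree) (hS : Disjoint S T.verts) (hl : l ∈ T.verts) {s : ℕ}
    (hs : s ∈ S) : (T.fork l S δ).children s = ∅ := by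
  have hsv := Finset.disjoint_left.1 hS hs
  have hsl : s ≠ l := by rintro rfl; exact hsv hl
  rw [children_fork_old hS hsl, Finset.eq_empty_iff_forall_notMem]
  intro c hc
  obtain ⟨-, hcv, rfl⟩ := mem_children.1 hc
  exact hsv (hT.parent_mem c hcv)

theorem leaves_fork (hT : T.IsTree) (hS : Disjoint S T.verts) (hl : l ∈ T.leaves)
    (hne : S.Nonempty) : (T.fork l S δ).leaves = T.leaves.erase l ∪ S := by
  ext u
  rw [mem_leaves, mem_verts_fork, Finset.mem_union, Finset.mem_erase, mem_leaves]
  constructor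
  · rintro ⟨hu | hu, hc⟩
    · have hul : u ≠ l := fun h => hne.ne_empty (by rwa [h, hT.children_fork_self hS hl] at hc)
      exact Or.inl ⟨hul, hu, by rwa [children_fork_old hS hul] at hc⟩
    · exact Or.inr hu
  · rintro (⟨hul, hu, hc⟩ | hu)
    · exact ⟨Or.inl hu, by rwa [children_fork_old hS hul]⟩
    · exact ⟨Or.inr hu, hT.children_fork_new hS (mem_leaves.1 hl).1 hu⟩

theorem config_fork_self (hT : T.IsTree) (hS : Disjoint S T.verts) (hl : l ∈ T.leaves)
    (hne : S.Nonempty) {y : ℕ → ℕ} (hy : y ∈ (T.fork l S δ).configs k) : y l = 0 := by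
  refine hy.1 l ?_
  rw [hT.leaves_fork hS hl hne]
  simp [notMem_of_mem_leaves hS hl]

theorem mass_fork_new (hT : T.IsTree) (hS : Disjoint S T.verts) (hl : l ∈ T.leaves)
    (hδ : 0 < δ) (y : ℕ → ℕ) {s : ℕ} (hs : s ∈ S) : (T.fork l S δ).mass y s = y s :=
  (hT.fork hS (mem_leaves.1 hl).1 hδ).mass_leaf y <| mem_leaves.2
    ⟨mem_verts_fork.2 (Or.inr hs), hT.children_fork_new hS (mem_leaves.1 hl).1 hs⟩

theorem mass_fork_old (hT : T.IsTree) (hS : Disjoint S T.verts) (hl : l ∈ T.leaves) (hδ : 0 < δ)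
    (y : ℕ → ℕ) {u : ℕ} (hu : u ∈ T.verts) :
    (T.fork l S δ).mass y u = T.mass (gather l S y) u := by
  have hT' := hT.fork (δ := δ) hS (mem_leaves.1 hl).1 hδ
  induction hu using hT.leaf_induction with
  | step u hu ih =>
    rw [hT'.mass_eq y (mem_verts_fork.2 (Or.inl hu))]
    rcases eq_or_ne u l with rfl | hul
    · rw [hT.children_fork_self hS hl, hT.mass_leaf _ hl, gather_self,
        Finset.sum_congr rfl fun s hs => hT.mass_fork_new hS hl hδ y hs]
    · rw [hT.mass_eq _ hu, children_fork_old hS hul,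
        gather_of_ne hul (Finset.disjoint_right.1 hS hu), Finset.sum_congr rfl ih]

theorem sum_fork (hT : T.IsTree) (hS : Disjoint S T.verts) (G : ℕ → ℝ) :
    ∑ u ∈ (T.fork l S δ).verts.erase 0, (T.fork l S δ).len u * G u
      = ∑ u ∈ T.verts.erase 0, T.len u * G u + δ * ∑ s ∈ S, G s := by
  have h0S : (0 : ℕ) ∉ S := Finset.disjoint_right.1 hS hT.root_mem
  change ∑ u ∈ (T.verts ∪ S).erase 0, (if u ∈ S then δ else T.len u) * G u = _
  rw [Finset.erase_union_distrib, Finset.erase_eq_of_notMem h0S,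
    Finset.sum_union (hS.symm.mono_left (Finset.erase_subset _ _)), Finset.mul_sum]
  refine congrArg₂ _ (Finset.sum_congr rfl fun u hu => ?_) (Finset.sum_congr rfl fun u hu => ?_)
  · rw [if_neg (Finset.disjoint_right.1 hS (Finset.mem_of_mem_erase hu))]
  · rw [if_pos hu]

theorem potential_fork (hT : T.IsTree) (hS : Disjoint S T.verts) (hl : l ∈ T.leaves)
    (hδ : 0 < δ) (φ : ℝ → ℝ) (y : ℕ → ℕ) :
    (T.fork l S δ).potential φ y = T.potential φ (gather l S y) + δ * ∑ s ∈ S, φ (y s) := by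
  rw [potential, hT.sum_fork hS]
  refine congrArg₂ _ (Finset.sum_congr rfl fun u hu => ?_)
    (congrArg _ (Finset.sum_congr rfl fun s hs => ?_))
  · rw [hT.mass_fork_old hS hl hδ y (Finset.mem_of_mem_erase hu)]
  · rw [hT.mass_fork_new hS hl hδ y hs]

theorem OT_fork (hT : T.IsTree) (hS : Disjoint S T.verts) (hl : l ∈ T.leaves) (hδ : 0 < δ)
    (x y : ℕ → ℕ) :
    (T.fork l S δ).OT x y
      = T.OT (gather l S x) (gather l S y) + δ * ∑ s ∈ S, |(x s : ℝ) - y s| := by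
  rw [OT, hT.sum_fork hS]
  refine congrArg₂ _ (Finset.sum_congr rfl fun u hu => ?_)
    (congrArg _ (Finset.sum_congr rfl fun s hs => ?_))
  · rw [hT.mass_fork_old hS hl hδ x (Finset.mem_of_mem_erase hu),
      hT.mass_fork_old hS hl hδ y (Finset.mem_of_mem_erase hu)]
  · rw [hT.mass_fork_new hS hl hδ x hs, hT.mass_fork_new hS hl hδ y hs]

end IsTree

theorem IsSimpleTree.fork (hT : T.IsSimpleTree) (hS : Disjoint S T.verts) (hl : l ∈ T.leaves)
    (hcard : 2 ≤ S.card) (hδ : 0 < δ) : (T.fork l S δ).IsSimpleTree := by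
  have hlv := (mem_leaves.1 hl).1
  refine (hT.isTree.fork hS hlv hδ).isSimpleTree fun u hu hu0 => ?_
  rcases mem_verts_fork.1 hu with hu | hu
  · rcases eq_or_ne u l with rfl | hul
    · rw [hT.isTree.children_fork_self hS hl]
      omega
    · rw [children_fork_old hS hul]
      exact hT.simple u hu hu0
  · simp [hT.isTree.children_fork_new hS hlv hu]

theorem config_eq_zero_of_disjoint (hS : Disjoint S T.verts) {y : ℕ → ℕ} (hy : y ∈ T.configs k) :
    ∀ s ∈ S, y s = 0 :=
  fun s hs => hy.1 s fun h => notMem_of_mem_leaves hS h hs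

theorem gather_eq_self (hS : Disjoint S T.verts) {y : ℕ → ℕ} (hy : y ∈ T.configs k) :
    gather l S y = y := by
  have h0 := config_eq_zero_of_disjoint hS hy
  funext v
  rw [gather]
  split_ifs with hvl hvS
  · rw [hvl, Finset.sum_eq_zero h0, add_zero]
  · exact (h0 v hvS).symm
  · rfl

theorem IsTree.sum_leaves_fork (hT : T.IsTree) (hS : Disjoint S T.verts) (hl : l ∈ T.leaves)
    (hne : S.Nonempty) (y : ℕ → ℕ) :
    ∑ u ∈ (T.fork l S δ).leaves, y u = ∑ u ∈ T.leaves.erase l, y u + ∑ s ∈ S, y s := by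
  rw [hT.leaves_fork hS hl hne, Finset.sum_union]
  exact Finset.disjoint_left.2 fun u hu => notMem_of_mem_leaves hS (Finset.mem_of_mem_erase hu)

theorem IsTree.gather_mem_configs (hT : T.IsTree) (hS : Disjoint S T.verts) (hl : l ∈ T.leaves)
    (hne : S.Nonempty) {y : ℕ → ℕ} (hy : y ∈ (T.fork l S δ).configs k) :
    gather l S y ∈ T.configs k := by
  refine ⟨fun u hu => ?_, ?_⟩
  · have hul : u ≠ l := fun h => hu (h ▸ hl)
    by_cases huS : u ∈ S
    · exact gather_of_mem hul huS
    · rw [gather_of_ne hul huS]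
      refine hy.1 u ?_
      simp [hT.leaves_fork hS hl hne, hu, huS]
  · have hold : ∀ u ∈ T.leaves.erase l, gather l S y u = y u := fun u hu =>
      gather_of_ne (Finset.ne_of_mem_erase hu)
        (notMem_of_mem_leaves hS (Finset.mem_of_mem_erase hu))
    rw [← hy.2, hT.sum_leaves_fork hS hl hne, ← Finset.add_sum_erase _ _ hl,
      Finset.sum_congr rfl hold, gather_self, hT.config_fork_self hS hl hne hy, zero_add, add_comm]

/-- A fork of `l` can be answered by sending all robots of `l` to one new leaf `s`. -/
theorem IsTree.exists_config_fork (hT : T.IsTree) (hS : Disjoint S T.verts) (hl : l ∈ T.leaves)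
    {s : ℕ} (hs : s ∈ S) {x : ℕ → ℕ} (hx : x ∈ T.configs k) :
    ∃ y ∈ (T.fork l S δ).configs k, gather l S y = x ∧ y s = x l ∧ ∀ s' ∈ S, s' ≠ s → y s' = 0 := by
  have hlS := notMem_of_mem_leaves hS hl
  have hsl : s ≠ l := fun h => hlS (h ▸ hs)
  have h0 := config_eq_zero_of_disjoint hS hx
  set y : ℕ → ℕ := Function.update (Function.update x l 0) s (x l) with hy
  have hys : y s = x l := Function.update_self ..
  have hyl : y l = 0 := by simp [hy, hsl.symm]
  have hne : ∀ v, v ≠ s → v ≠ l → y v = x v := fun v hvs hvl => by simp [hy, hvs, hvl]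
  have hnew : ∀ s' ∈ S, s' ≠ s → y s' = 0 := fun s' hs' hss' =>
    (hne s' hss' fun h => hlS (h ▸ hs')).trans (h0 s' hs')
  have hsum : ∑ s' ∈ S, y s' = x l := (Finset.sum_eq_single s hnew (absurd hs)).trans hys
  have hold : ∀ u ∈ T.leaves.erase l, y u = x u := fun u hu =>
    hne u (fun h => notMem_of_mem_leaves hS (Finset.mem_of_mem_erase hu) (h ▸ hs))
      (Finset.ne_of_mem_erase hu)
  refine ⟨y, ⟨fun u hu => ?_, ?_⟩, funext fun v => ?_, hys, hnew⟩
  · rw [hT.leaves_fork hS hl ⟨s, hs⟩, Finset.mem_union, not_or, Finset.mem_erase, not_and] at hu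
    rcases eq_or_ne u l with rfl | hul
    · exact hyl
    · rw [hne u (fun h => hu.2 (h ▸ hs)) hul, hx.1 u (hu.1 hul)]
  · rw [hT.sum_leaves_fork hS hl ⟨s, hs⟩, hsum, Finset.sum_congr rfl hold, ← hx.2,
      Finset.sum_erase_add _ _ hl]
  · rcases eq_or_ne v l with rfl | hvl
    · rw [gather_self, hyl, hsum, zero_add]
    · by_cases hvS : v ∈ S
      · rw [gather_of_mem hvl hvS, h0 v hvS]
      · rw [gather_of_ne hvl hvS, hne v (fun h => hvS (h ▸ hs)) hvl]

theorem IsTree.fork_transfer_gain (hT : T.IsTree) (hS : Disjoint S T.verts) (hl : l ∈ T.leaves)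
    (hδ : 0 < δ) {y z : ℕ → ℕ} {a b : ℕ} (hab : a ≠ b) (hya : 1 ≤ y a)
    (hz : z = transfer (gather l S y) (if a ∈ S then l else a) (if b ∈ S then l else b)) :
    (T.fork l S δ).potential (phi k) (transfer y a b) + (T.fork l S δ).OT y (transfer y a b)
        - (T.fork l S δ).potential (phi k) y
      = T.potential (phi k) z + T.OT (gather l S y) z - T.potential (phi k) (gather l S y)
        + δ * ((if b ∈ S then 20 * k + 10 * (y b : ℝ) + 6 else 0)
          - (if a ∈ S then 20 * k + 10 * (y a : ℝ) - 6 else 0)) := by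
  have hsum := Finset.sum_congr (rfl : S = S) fun v _ => phi_transfer_add_abs k hab hya v
  rw [Finset.sum_add_distrib, Finset.sum_sub_distrib, Finset.sum_add_distrib, Finset.sum_ite_eq',
    Finset.sum_ite_eq'] at hsum
  rw [hT.potential_fork hS hl hδ, hT.potential_fork hS hl hδ, hT.OT_fork hS hl hδ,
    gather_transfer (notMem_of_mem_leaves hS hl) hya, ← hz]
  linear_combination δ * hsum

theorem IsTree.attracts_fork_old (hT : T.IsTree) (hk : 2 ≤ k) (hS : Disjoint S T.verts)
    (hl : l ∈ T.leaves) (hne : S.Nonempty) (hδ : 0 < δ) {i : ℕ} (hi : i ∈ T.leaves) (hil : i ≠ l)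
    (hA : T.Attracts k (phi k) i) : (T.fork l S δ).Attracts k (phi k) i := by
  intro y hy hyi
  have hiS := notMem_of_mem_leaves hS hi
  obtain ⟨j, hj, hji, hzj, hgain⟩ :=
    hA _ (hT.gather_mem_configs hS hl hne hy) (by rwa [gather_of_ne hil hiS])
  obtain ⟨s, hs, hsi, hys, hsj⟩ : ∃ s ∈ (T.fork l S δ).leaves, s ≠ i ∧ 1 ≤ y s ∧
      (if s ∈ S then l else s) = j := by
    rw [hT.leaves_fork hS hl hne]
    rcases eq_or_ne j l with rfl | hjl
    · rw [gather_self, hT.config_fork_self hS hl hne hy, zero_add, Nat.one_le_iff_ne_zero,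
        Ne, Finset.sum_eq_zero_iff, not_forall] at hzj
      obtain ⟨s, hs⟩ := hzj
      rw [Classical.not_imp] at hs
      exact ⟨s, Finset.mem_union_right _ hs.1, fun h => hiS (h ▸ hs.1),
        Nat.one_le_iff_ne_zero.2 hs.2, if_pos hs.1⟩
    · have hjS := notMem_of_mem_leaves hS hj
      exact ⟨j, Finset.mem_union_left _ (Finset.mem_erase.2 ⟨hjl, hj⟩), hji,
        by rwa [gather_of_ne hjl hjS] at hzj, if_neg hjS⟩
  refine ⟨s, hs, hsi, hys, ?_⟩
  have hchange := hT.fork_transfer_gain (k := k) hS hl hδ hsi hys (z := transfer (gather l S y) j i)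
    (by rw [hsj, if_neg hiS])
  have hnew : δ * (0 - if s ∈ S then 20 * k + 10 * (y s : ℝ) - 6 else 0) ≤ 0 := by
    have : (2 : ℝ) ≤ k := by exact_mod_cast hk
    have : (0 : ℝ) ≤ y s := Nat.cast_nonneg _
    exact mul_nonpos_of_nonneg_of_nonpos hδ.le (by split_ifs <;> linarith)
  rw [if_neg hiS] at hchange
  linarith

theorem IsTree.exists_fork_gain_of_gap (hT : T.IsTree) (hk : 2 ≤ k) {x : ℕ → ℕ}
    (hx : x ∈ T.configs k) (hst : T.Stable k (phi k) x) (hS : Disjoint S T.verts)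
    (hl : l ∈ T.leaves) (hδ : 0 < δ) (hsmall : l ≠ 0 → δ * (phi k k + k) < T.len l)
    {i : ℕ} (hi : i ∈ S) {y : ℕ → ℕ} (hy : y ∈ (T.fork l S δ).configs k) (hyi : y i = 0)
    (hgap : gather l S y l + 2 ≤ x l) :
    ∃ j ∈ (T.fork l S δ).leaves, j ≠ i ∧ 1 ≤ y j ∧
      (T.fork l S δ).potential (phi k) (transfer y j i) + (T.fork l S δ).OT y (transfer y j i)
        < (T.fork l S δ).potential (phi k) y := by
  obtain ⟨j, hj, hjl, hzj, hgain⟩ :=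
    hT.exists_gain hk hx (hT.gather_mem_configs hS hl ⟨i, hi⟩ hy) hst hl hgap
  have hjS := notMem_of_mem_leaves hS hj
  rw [gather_of_ne hjl hjS] at hzj
  have hji : j ≠ i := fun h => hjS (h ▸ hi)
  refine ⟨j, ?_, hji, hzj, ?_⟩
  · rw [hT.leaves_fork hS hl ⟨i, hi⟩]
    exact Finset.mem_union_left _ (Finset.mem_erase.2 ⟨hjl, hj⟩)
  · have hl0 := hT.leaf_ne_zero_of_ne hl (mem_leaves.1 hj).1 hjl
    have hchange := hT.fork_transfer_gain (k := k) hS hl hδ hji hzj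
      (z := transfer (gather l S y) j l) (by rw [if_neg hjS, if_pos hi])
    have hcost : δ * (20 * k + 10 * ((0 : ℕ) : ℝ) + 6 - 0) ≤ δ * (phi k k + k) := by
      have : (2 : ℝ) ≤ k := by exact_mod_cast hk
      refine mul_le_mul_of_nonneg_left ?_ hδ.le
      simp only [phi, Nat.cast_zero]
      nlinarith
    rw [if_pos hi, if_neg hjS, hyi] at hchange
    linarith [hsmall hl0, hT.len_pos l (mem_leaves.1 hl).1 hl0]

theorem IsTree.fork_gain_of_crowded (hT : T.IsTree) (hS : Disjoint S T.verts) (hl : l ∈ T.leaves)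
    (hδ : 0 < δ) {i s : ℕ} (hi : i ∈ S) (hs : s ∈ S) {y : ℕ → ℕ} (hyi : y i = 0) (hys : 2 ≤ y s) :
    (T.fork l S δ).potential (phi k) (transfer y s i) + (T.fork l S δ).OT y (transfer y s i)
      < (T.fork l S δ).potential (phi k) y := by
  have hsi : s ≠ i := by rintro rfl; omega
  have hgl : 1 ≤ gather l S y l := by
    have := Finset.single_le_sum (f := y) (fun _ _ => Nat.zero_le _) hs
    rw [gather_self]
    omega
  have hchange := hT.fork_transfer_gain (k := k) hS hl hδ hsi (one_le_two.trans hys)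
    (z := gather l S y) (by rw [if_pos hs, if_pos hi, transfer_self hgl])
  have hys' : (2 : ℝ) ≤ y s := by exact_mod_cast hys
  rw [if_pos hi, if_pos hs, hyi, Nat.cast_zero, OT_self] at hchange
  nlinarith

/-- If an empty new leaf is not fed from outside the fork, then another new leaf holds two robots,
because the fork has at most `x l - 1` new leaves. -/
theorem IsTree.attracts_fork_new (hT : T.IsTree) (hk : 2 ≤ k) {x : ℕ → ℕ} (hx : x ∈ T.configs k)
    (hst : T.Stable k (phi k) x) (hF : T.CanFork x l S) (hδ : 0 < δ)
    (hsmall : l ≠ 0 → δ * (phi k k + k) < T.len l) {i : ℕ} (hi : i ∈ S) :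
    (T.fork l S δ).Attracts k (phi k) i := by
  obtain ⟨hl, hS, -, hxl⟩ := hF
  intro y hy hyi
  by_cases hgap : gather l S y l + 2 ≤ x l
  · exact hT.exists_fork_gain_of_gap hk hx hst hS hl hδ hsmall hi hy hyi hgap
  · obtain ⟨s, hs, hys⟩ : ∃ s ∈ S.erase i, 1 < y s := by
      refine Finset.exists_lt_of_sum_lt (f := fun _ => 1) ?_
      have hsum := Finset.add_sum_erase S y hi
      rw [gather_self, hT.config_fork_self hS hl ⟨i, hi⟩ hy] at hgap
      rw [Finset.sum_const, smul_eq_mul, mul_one, Finset.card_erase_of_mem hi]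
      have := Finset.card_pos.2 ⟨i, hi⟩
      omega
    have hsS := Finset.mem_of_mem_erase hs
    refine ⟨s, ?_, Finset.ne_of_mem_erase hs, hys.le,
      hT.fork_gain_of_crowded hS hl hδ hi hsS hyi hys⟩
    rw [hT.leaves_fork hS hl ⟨i, hi⟩]
    exact Finset.mem_union_right _ hsS

theorem IsTree.attracts_fork (hT : T.IsTree) (hk : 2 ≤ k) {x : ℕ → ℕ} (hx : x ∈ T.configs k)
    (hst : T.Stable k (phi k) x) (hF : T.CanFork x l S) (hδ : 0 < δ)
    (hsmall : l ≠ 0 → δ * (phi k k + k) < T.len l) (hA : ∀ i ∈ T.leaves, T.Attracts k (phi k) i) :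
    ∀ i ∈ (T.fork l S δ).leaves, (T.fork l S δ).Attracts k (phi k) i := by
  intro i hi
  have hne : S.Nonempty := Finset.card_pos.1 (two_pos.trans_le hF.2.2.1)
  rw [hT.leaves_fork hF.2.1 hF.1 hne, Finset.mem_union, Finset.mem_erase] at hi
  rcases hi with ⟨hil, hi⟩ | hi
  · exact hT.attracts_fork_old hk hF.2.1 hF.1 hne hδ hi hil (hA i hi)
  · exact hT.attracts_fork_new hk hx hst hF hδ hsmall hi

end Fork

end WTree

namespace WTree

variable {T : WTree} {k : ℕ}

/-! ### Kills -/

/-- The vertex `p ≠ 0` is removed, and its children are attached to the parent of `p` by edges that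
are longer by the length of the edge of `p`. A kill consists of one or two such steps: the killed
leaf is suppressed, and then its parent if that has become a vertex of degree two. -/
noncomputable def suppress (T : WTree) (p : ℕ) : WTree where
  verts := T.verts.erase p
  parent := fun v => if v = p then v else if T.parent v = p then T.parent p else T.parent v
  len := fun v => if v = p then 0 else if T.parent v = p then T.len p + T.len v else T.len v

section Suppress

variable {p : ℕ}

theorem mem_verts_suppress {v : ℕ} : v ∈ (T.suppress p).verts ↔ v ≠ p ∧ v ∈ T.verts :=
  Finset.mem_erase

theorem parent_suppress {v : ℕ} (hv : v ≠ p) :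
    (T.suppress p).parent v = if T.parent v = p then T.parent p else T.parent v := if_neg hv

theorem len_suppress {v : ℕ} (hv : v ≠ p) :
    (T.suppress p).len v = if T.parent v = p then T.len p + T.len v else T.len v := if_neg hv

theorem Desc.of_suppress {v u : ℕ} (h : (T.suppress p).Desc v u) : T.Desc v u := by
  have hparent (v : ℕ) : T.Desc v ((T.suppress p).parent v) := by
    simp only [suppress]
    split_ifs with hv hp
    · exact Desc.refl T v
    · exact (hp ▸ T.desc_parent v).trans (T.desc_parent p)
    · exact T.desc_parent v
  obtain ⟨n, rfl⟩ := h
  induction n generalizing v with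
  | zero => exact Desc.refl T v
  | succ n ih => exact (hparent v).trans ih

namespace IsTree

theorem desc_suppress (hT : T.IsTree) (hp : p ∈ T.verts) (hp0 : p ≠ 0) {v u : ℕ} (hv : v ≠ p)
    (hu : u ≠ p) : (T.suppress p).Desc v u ↔ T.Desc v u := by
  refine ⟨Desc.of_suppress, fun h => ?_⟩
  suffices key : (T.suppress p).Desc (if v = p then T.parent p else v) u by rwa [if_neg hv] at key
  clear hv
  obtain ⟨n, hn⟩ := h
  induction n generalizing v with
  | zero =>
    obtain rfl : v = u := hn
    rw [if_neg hu]
    exact Desc.refl _ v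
  | succ n ih =>
    have hparent := ih hn
    split_ifs with hv
    · rwa [hv, if_neg (hT.parent_ne hp hp0)] at hparent
    · exact desc_iff.2 (Or.inr (by rwa [parent_suppress hv]))

theorem suppress (hT : T.IsTree) (hp : p ∈ T.verts) (hp0 : p ≠ 0) : (T.suppress p).IsTree := by
  have h0 : T.parent 0 ≠ p := hT.parent_root.trans_ne hp0.symm
  refine ⟨mem_verts_suppress.2 ⟨hp0.symm, hT.root_mem⟩, fun u hu => ?_, fun u hu => ?_,
    fun u hu hu0 => ?_, ?_, ?_, fun u hu => ?_⟩
  · obtain ⟨hup, hu⟩ := mem_verts_suppress.1 hu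
    rw [parent_suppress hup]
    split_ifs with h
    · exact mem_verts_suppress.2 ⟨hT.parent_ne hp hp0, hT.parent_mem p hp⟩
    · exact mem_verts_suppress.2 ⟨h, hT.parent_mem u hu⟩
  · obtain ⟨hup, hu⟩ := mem_verts_suppress.1 hu
    exact (hT.desc_suppress hp hp0 hup hp0.symm).2 (hT.desc_root u hu)
  · obtain ⟨hup, hu⟩ := mem_verts_suppress.1 hu
    rw [len_suppress hup]
    split_ifs
    · exact add_pos (hT.len_pos p hp hp0) (hT.len_pos u hu hu0)
    · exact hT.len_pos u hu hu0
  · rw [parent_suppress hp0.symm, if_neg h0, hT.parent_root]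
  · rw [len_suppress hp0.symm, if_neg h0, hT.len_root]
  · rcases eq_or_ne u p with rfl | hup
    · exact ⟨if_pos rfl, if_pos rfl⟩
    · obtain ⟨hparent, hlen⟩ := hT.off_verts u fun h => hu (mem_verts_suppress.2 ⟨hup, h⟩)
      rw [parent_suppress hup, len_suppress hup, hparent, if_neg hup, if_neg hup]
      exact ⟨rfl, hlen⟩

theorem mass_suppress (hT : T.IsTree) (hp : p ∈ T.verts) (hp0 : p ≠ 0) {y : ℕ → ℕ} (hy : y p = 0)
    {u : ℕ} (hu : u ≠ p) : (T.suppress p).mass y u = T.mass y u := by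
  classical
  rw [mass, mass, Finset.sum_filter, Finset.sum_filter, ← Finset.add_sum_erase _ _ hp, hy, ite_self,
    zero_add]
  refine Finset.sum_congr rfl fun v hv => ?_
  rw [hT.desc_suppress hp hp0 (Finset.ne_of_mem_erase hv) hu]

end IsTree

theorem children_suppress {u : ℕ} (hu : u ≠ T.parent p) (hup : u ≠ p) :
    (T.suppress p).children u = T.children u := by
  ext c
  rw [mem_children, mem_children, mem_verts_suppress]
  rcases eq_or_ne c p with rfl | hcp
  · simp only [ne_eq, not_true_eq_false, false_and, and_false, hu.symm]
  · rw [parent_suppress hcp]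
    split_ifs with h
    · simp only [hu.symm, h, hup.symm, and_false]
    · simp only [ne_eq, hcp, not_false_eq_true, true_and]

theorem IsTree.children_suppress_parent (hT : T.IsTree) (hp : p ∈ T.verts) (hp0 : p ≠ 0) :
    (T.suppress p).children (T.parent p) = (T.children (T.parent p)).erase p ∪ T.children p := by
  ext c
  rw [Finset.mem_union, Finset.mem_erase, mem_children, mem_children, mem_children,
    mem_verts_suppress]
  have hpp := hT.parent_ne hp hp0
  rcases eq_or_ne c p with rfl | hcp
  · simp only [ne_eq, not_true_eq_false, false_and, and_false, hpp, or_self]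
  · rw [parent_suppress hcp]
    split_ifs with h
    · simp only [h, hpp.symm, hcp, and_true, ne_eq, not_false_eq_true, true_and, and_false,
        false_or]
    · simp only [h, hcp, ne_eq, not_false_eq_true, true_and, and_false, or_false]

theorem IsTree.card_children_suppress (hT : T.IsTree) (hp : p ∈ T.verts) (hp0 : p ≠ 0)
    (hcard : (T.children p).card = 1) {u : ℕ} (hu : u ≠ p) :
    ((T.suppress p).children u).card = (T.children u).card := by
  rcases eq_or_ne u (T.parent p) with rfl | hup
  · have hpmem : p ∈ T.children (T.parent p) := mem_children.2 ⟨hp0, hp, rfl⟩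
    rw [hT.children_suppress_parent hp hp0, Finset.card_union_of_disjoint, hcard,
      Finset.card_erase_add_one hpmem]
    refine Finset.disjoint_left.2 fun c hc hcp => hu ?_
    rw [← (mem_children.1 (Finset.mem_of_mem_erase hc)).2.2, (mem_children.1 hcp).2.2]
  · rw [children_suppress hup hu]

theorem IsTree.leaves_suppress (hT : T.IsTree) (hp : p ∈ T.verts) (hp0 : p ≠ 0)
    (h : T.children p = ∅ → ∃ c ∈ T.children (T.parent p), c ≠ p) :
    (T.suppress p).leaves = T.leaves.erase p := by
  ext u
  rw [Finset.mem_erase, mem_leaves, mem_leaves, mem_verts_suppress, and_assoc]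
  refine and_congr_right fun hup => and_congr_right fun _ => ?_
  rcases eq_or_ne u (T.parent p) with rfl | hu
  · have hpmem : p ∈ T.children (T.parent p) := mem_children.2 ⟨hp0, hp, rfl⟩
    refine iff_of_false (fun h0 => ?_) (Finset.ne_empty_of_mem hpmem)
    rw [hT.children_suppress_parent hp hp0, Finset.union_eq_empty] at h0
    obtain ⟨c, hc, hcp⟩ := h h0.2
    exact Finset.ne_empty_of_mem (Finset.mem_erase.2 ⟨hcp, hc⟩) h0.1
  · rw [children_suppress hu hup]

theorem IsTree.sum_suppress (hT : T.IsTree) (hp : p ∈ T.verts) (hp0 : p ≠ 0) (G : ℕ → ℝ)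
    (hG : G p = ∑ c ∈ T.children p, G c) :
    ∑ u ∈ (T.suppress p).verts.erase 0, (T.suppress p).len u * G u
      = ∑ u ∈ T.verts.erase 0, T.len u * G u := by
  have hpmem : p ∈ T.verts.erase 0 := Finset.mem_erase.2 ⟨hp0, hp⟩
  have hchildren : ((T.verts.erase 0).erase p).filter (T.parent · = p) = T.children p := by
    rw [Finset.filter_erase, children, Finset.erase_eq_of_notMem]
    exact fun h => hT.parent_ne hp hp0 (Finset.mem_filter.1 h).2
  calc ∑ u ∈ (T.suppress p).verts.erase 0, (T.suppress p).len u * G u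
      = ∑ u ∈ (T.verts.erase 0).erase p,
          (T.len u * G u + if T.parent u = p then T.len p * G u else 0) := by
        refine Finset.sum_congr Finset.erase_right_comm fun u hu => ?_
        rw [len_suppress (Finset.ne_of_mem_erase hu)]
        split_ifs <;> ring
    _ = ∑ u ∈ (T.verts.erase 0).erase p, T.len u * G u + T.len p * G p := by
        rw [Finset.sum_add_distrib, ← Finset.sum_filter, hchildren, ← Finset.mul_sum, hG]
    _ = ∑ u ∈ T.verts.erase 0, T.len u * G u := Finset.sum_erase_add _ _ hpmem

theorem IsTree.apply_mass_eq_sum_children (hT : T.IsTree) (hp : p ∈ T.verts)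
    (hcard : (T.children p).card ≤ 1) {x y : ℕ → ℕ} (hx : x p = 0) (hy : y p = 0)
    {F : ℕ → ℕ → ℝ} (hF : F 0 0 = 0) :
    F (T.mass x p) (T.mass y p) = ∑ c ∈ T.children p, F (T.mass x c) (T.mass y c) := by
  rw [hT.mass_eq x hp, hT.mass_eq y hp, hx, hy, zero_add, zero_add]
  rcases Finset.card_le_one_iff_subset_singleton.1 hcard with ⟨c, hc⟩
  rcases Finset.subset_singleton_iff.1 hc with h | h
  · simp only [h, Finset.sum_empty, hF]
  · simp only [h, Finset.sum_singleton]

theorem IsTree.potential_suppress (hT : T.IsTree) (hp : p ∈ T.verts) (hp0 : p ≠ 0)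
    (hcard : (T.children p).card ≤ 1) {φ : ℝ → ℝ} (hφ : φ 0 = 0) {y : ℕ → ℕ} (hy : y p = 0) :
    (T.suppress p).potential φ y = T.potential φ y := by
  refine Eq.trans (Finset.sum_congr rfl fun u hu => ?_) (hT.sum_suppress hp hp0
    (fun u => φ (T.mass y u)) (hT.apply_mass_eq_sum_children hp hcard hy hy
      (F := fun m _ => φ m) (by rw [Nat.cast_zero, hφ])))
  rw [hT.mass_suppress hp hp0 hy (mem_verts_suppress.1 (Finset.mem_of_mem_erase hu)).1]

theorem IsTree.OT_suppress (hT : T.IsTree) (hp : p ∈ T.verts) (hp0 : p ≠ 0)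
    (hcard : (T.children p).card ≤ 1) {x y : ℕ → ℕ} (hx : x p = 0) (hy : y p = 0) :
    (T.suppress p).OT x y = T.OT x y := by
  refine Eq.trans (Finset.sum_congr rfl fun u hu => ?_) (hT.sum_suppress hp hp0
    (fun u => |(T.mass x u : ℝ) - T.mass y u|) (hT.apply_mass_eq_sum_children hp hcard hx hy
      (F := fun m n => |(m : ℝ) - n|) (by rw [sub_self, abs_zero])))
  have hup := (mem_verts_suppress.1 (Finset.mem_of_mem_erase hu)).1
  rw [hT.mass_suppress hp hp0 hx hup, hT.mass_suppress hp hp0 hy hup]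

end Suppress

section Kill

variable {l : ℕ}

theorem CanKill.ne_zero (hT : T.IsTree) (h : T.CanKill l) : l ≠ 0 := by
  obtain ⟨hl, j, hj, hjl⟩ := h
  exact hT.leaf_ne_zero_of_ne hl (mem_leaves.1 hj).1 hjl

theorem CanKill.mem_children (hT : T.IsTree) (h : T.CanKill l) : l ∈ T.children (T.parent l) :=
  WTree.mem_children.2 ⟨h.ne_zero hT, (mem_leaves.1 h.1).1, rfl⟩

theorem CanKill.siblings_nonempty (hT : T.IsSimpleTree) (h : T.CanKill l) :
    (T.siblings l).Nonempty := by
  have hlp := h.mem_children hT.isTree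
  obtain ⟨hl, j, hj, hjl⟩ := h
  have hlv := (mem_leaves.1 hl).1
  have hjv := (mem_leaves.1 hj).1
  rcases eq_or_ne (T.parent l) 0 with hp0 | hp0
  · have hj0 : j ≠ 0 := by
      rintro rfl
      exact notMem_leaves_of_mem_children (hp0 ▸ hlp) hj
    obtain ⟨c, hc, hjc⟩ := hT.isTree.exists_child hjv (hT.desc_root j hjv) hj0
    refine ⟨c, Finset.mem_erase.2 ⟨?_, hp0.symm ▸ hc⟩⟩
    rintro rfl
    exact hjl (hT.isTree.eq_of_desc_leaf hjv hl hjc)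
  · rw [siblings, ← Finset.card_pos, Finset.card_erase_of_mem hlp]
    have := hT.simple _ (hT.parent_mem l hlv) hp0
    have := Finset.card_pos.2 ⟨l, hlp⟩
    omega

namespace IsTree

theorem parent_ne_leaf (hT : T.IsTree) (hl : l ∈ T.leaves) (hl0 : l ≠ 0) {v : ℕ} (hv : v ≠ l) :
    T.parent v ≠ l := by
  intro h
  by_cases hvT : v ∈ T.verts
  · refine notMem_leaves_of_mem_children (WTree.mem_children.2 ⟨?_, hvT, h⟩) hl
    rintro rfl
    exact hl0 (h.symm.trans hT.parent_root)
  · exact hv ((hT.off_verts v hvT).1.symm.trans h)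

theorem suppress_leaf_parent (hT : T.IsTree) (hl : l ∈ T.leaves) (hl0 : l ≠ 0) :
    (T.suppress l).parent = fun v => if v = l then v else T.parent v := by
  funext v
  simp only [WTree.suppress]
  split_ifs with hv hp
  exacts [rfl, absurd hp (hT.parent_ne_leaf hl hl0 hv), rfl]

theorem suppress_leaf_len (hT : T.IsTree) (hl : l ∈ T.leaves) (hl0 : l ≠ 0) :
    (T.suppress l).len = fun v => if v = l then 0 else T.len v := by
  funext v
  simp only [WTree.suppress]
  split_ifs with hv hp
  exacts [rfl, absurd hp (hT.parent_ne_leaf hl hl0 hv), rfl]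

theorem mem_siblings (hT : T.IsTree) (hp0 : T.parent l ≠ 0) {v : ℕ} (hv : v ≠ T.parent l) :
    v ∈ T.siblings l ↔ v ≠ l ∧ T.parent v = T.parent l := by
  rw [siblings, Finset.mem_erase, WTree.mem_children]
  refine and_congr_right fun _ => ⟨fun h => h.2.2, fun h => ⟨?_, ?_, h⟩⟩
  · rintro rfl
    exact hp0 (h.symm.trans hT.parent_root)
  · by_contra hvT
    exact hv ((hT.off_verts v hvT).1.symm.trans h)

theorem kill_eq_suppress (hT : T.IsTree) (hl : l ∈ T.leaves) (hl0 : l ≠ 0)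
    (h : ¬ (T.parent l ≠ 0 ∧ (T.siblings l).card = 1)) : T.kill l = T.suppress l := by
  rw [kill, if_neg h]
  exact WTree.ext rfl (hT.suppress_leaf_parent hl hl0).symm (hT.suppress_leaf_len hl hl0).symm

theorem kill_eq_suppress_suppress (hT : T.IsTree) (hl : l ∈ T.leaves) (hl0 : l ≠ 0)
    (h : T.parent l ≠ 0 ∧ (T.siblings l).card = 1) :
    T.kill l = (T.suppress l).suppress (T.parent l) := by
  have hpl := hT.parent_ne (mem_leaves.1 hl).1 hl0
  rw [kill, if_pos h]
  refine WTree.ext rfl (funext fun v => ?_) (funext fun v => ?_) <;>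
    rcases eq_or_ne v (T.parent l) with rfl | hvp
  · exact (if_pos (Or.inr rfl)).trans (if_pos rfl).symm
  · simp only [parent_suppress hvp, hT.suppress_leaf_parent hl hl0, hT.mem_siblings h.1 hvp, hvp,
      or_false, if_neg hpl]
    split_ifs <;> simp_all
  · exact (if_pos (Or.inr rfl)).trans (if_pos rfl).symm
  · simp only [len_suppress hvp, hT.suppress_leaf_parent hl hl0, hT.suppress_leaf_len hl hl0,
      hT.mem_siblings h.1 hvp, hvp, or_false, if_neg hpl]
    split_ifs <;> simp_all

theorem suppress_leaf_children_parent (hT : T.IsTree) (hl : l ∈ T.leaves) (hl0 : l ≠ 0) :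
    (T.suppress l).children (T.parent l) = T.siblings l := by
  rw [hT.children_suppress_parent (mem_leaves.1 hl).1 hl0, (mem_leaves.1 hl).2, Finset.union_empty,
    siblings]

end IsTree

theorem CanKill.kill_cases (hT : T.IsTree) (h : T.CanKill l) :
    (T.kill l = T.suppress l ∧ (T.parent l ≠ 0 → (T.siblings l).card ≠ 1)) ∨
      (T.kill l = (T.suppress l).suppress (T.parent l) ∧ T.parent l ∈ (T.suppress l).verts ∧
        T.parent l ≠ 0 ∧ ((T.suppress l).children (T.parent l)).card = 1) := by
  have hl0 := h.ne_zero hT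
  have hlv := (mem_leaves.1 h.1).1
  by_cases hcase : T.parent l ≠ 0 ∧ (T.siblings l).card = 1
  · exact Or.inr ⟨hT.kill_eq_suppress_suppress h.1 hl0 hcase,
      mem_verts_suppress.2 ⟨hT.parent_ne hlv hl0, hT.parent_mem l hlv⟩, hcase.1,
      by rw [hT.suppress_leaf_children_parent h.1 hl0, hcase.2]⟩
  · exact Or.inl ⟨hT.kill_eq_suppress h.1 hl0 hcase, not_and.1 hcase⟩

theorem CanKill.isSimpleTree_kill (hT : T.IsSimpleTree) (h : T.CanKill l) :
    (T.kill l).IsSimpleTree := by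
  have hl0 := h.ne_zero hT.isTree
  have hlv := (mem_leaves.1 h.1).1
  have hS := hT.isTree.suppress hlv hl0
  have hsimple : ∀ u ∈ (T.suppress l).verts, u ≠ 0 → u ≠ T.parent l →
      ((T.suppress l).children u).card ≠ 1 := fun u hu hu0 hup => by
    obtain ⟨hul, hu⟩ := mem_verts_suppress.1 hu
    rw [children_suppress hup hul]
    exact hT.simple u hu hu0
  obtain ⟨hkill, hcard⟩ | ⟨hkill, hp, hp0, hcard⟩ := h.kill_cases hT.isTree
  · rw [hkill]
    refine hS.isSimpleTree fun u hu hu0 => ?_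
    rcases eq_or_ne u (T.parent l) with rfl | hup
    · rw [hT.isTree.suppress_leaf_children_parent h.1 hl0]
      exact hcard hu0
    · exact hsimple u hu hu0 hup
  · rw [hkill]
    refine (hS.suppress hp hp0).isSimpleTree fun u hu hu0 => ?_
    obtain ⟨hup, hu⟩ := mem_verts_suppress.1 hu
    rw [hS.card_children_suppress hp hp0 hcard hup]
    exact hsimple u hu hu0 hup

theorem CanKill.leaves_kill (hT : T.IsSimpleTree) (h : T.CanKill l) :
    (T.kill l).leaves = T.leaves.erase l := by
  have hl0 := h.ne_zero hT.isTree
  have hlv := (mem_leaves.1 h.1).1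
  have hleaves : (T.suppress l).leaves = T.leaves.erase l := by
    refine hT.isTree.leaves_suppress hlv hl0 fun _ => ?_
    obtain ⟨c, hc⟩ := h.siblings_nonempty hT
    exact ⟨c, Finset.mem_of_mem_erase hc, Finset.ne_of_mem_erase hc⟩
  obtain ⟨hkill, -⟩ | ⟨hkill, hp, hp0, hcard⟩ := h.kill_cases hT.isTree
  · rw [hkill, hleaves]
  · have hne : (T.suppress l).children (T.parent l) ≠ ∅ := by
      rw [← Finset.card_eq_zero.ne, hcard]
      exact one_ne_zero
    rw [hkill, (hT.isTree.suppress hlv hl0).leaves_suppress hp hp0 fun h => absurd h hne, hleaves,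
      Finset.erase_eq_of_notMem]
    exact fun hp => notMem_leaves_of_mem_children (h.mem_children hT.isTree)
      (Finset.mem_of_mem_erase hp)

theorem CanKill.verts_kill_subset (hT : T.IsTree) (h : T.CanKill l) :
    (T.kill l).verts ⊆ T.verts.erase l := by
  obtain ⟨hkill, -⟩ | ⟨hkill, -⟩ := h.kill_cases hT <;> rw [hkill]
  exacts [subset_rfl, Finset.erase_subset _ _]

theorem CanKill.mem_configs_kill (hT : T.IsSimpleTree) (h : T.CanKill l) {y : ℕ → ℕ} :
    y ∈ (T.kill l).configs k ↔ y ∈ T.configs k ∧ y l = 0 := by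
  have hsum := Finset.add_sum_erase T.leaves y h.1
  simp only [configs, Set.mem_ofPred_eq, h.leaves_kill hT, Finset.mem_erase, not_and_or, not_not]
  constructor
  · rintro ⟨h0, hk⟩
    have hyl : y l = 0 := h0 l (Or.inl rfl)
    exact ⟨⟨fun u hu => h0 u (Or.inr hu), by omega⟩, hyl⟩
  · rintro ⟨⟨h0, hk⟩, hyl⟩
    refine ⟨fun u hu => hu.elim ?_ (h0 u), by omega⟩
    rintro rfl
    exact hyl

theorem CanKill.apply_parent (hT : T.IsTree) (h : T.CanKill l) {y : ℕ → ℕ} (hy : y ∈ T.configs k) :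
    y (T.parent l) = 0 :=
  hy.1 _ (notMem_leaves_of_mem_children (h.mem_children hT))

theorem CanKill.potential_kill (hT : T.IsSimpleTree) (h : T.CanKill l) {φ : ℝ → ℝ} (hφ : φ 0 = 0)
    {y : ℕ → ℕ} (hy : y ∈ (T.kill l).configs k) : (T.kill l).potential φ y = T.potential φ y := by
  obtain ⟨hy, hyl⟩ := (h.mem_configs_kill hT).1 hy
  have hl0 := h.ne_zero hT.isTree
  obtain ⟨hlv, hempty⟩ := mem_leaves.1 h.1
  have hleaf := hT.isTree.potential_suppress hlv hl0 (by simp [hempty]) hφ hyl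
  obtain ⟨hkill, -⟩ | ⟨hkill, hp, hp0, hcard⟩ := h.kill_cases hT.isTree
  · rw [hkill, hleaf]
  · rw [hkill, (hT.isTree.suppress hlv hl0).potential_suppress hp hp0 hcard.le hφ
      (h.apply_parent hT.isTree hy), hleaf]

theorem CanKill.OT_kill (hT : T.IsSimpleTree) (h : T.CanKill l) {x y : ℕ → ℕ}
    (hx : x ∈ (T.kill l).configs k) (hy : y ∈ (T.kill l).configs k) :
    (T.kill l).OT x y = T.OT x y := by
  obtain ⟨hx, hxl⟩ := (h.mem_configs_kill hT).1 hx
  obtain ⟨hy, hyl⟩ := (h.mem_configs_kill hT).1 hy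
  have hl0 := h.ne_zero hT.isTree
  obtain ⟨hlv, hempty⟩ := mem_leaves.1 h.1
  have hleaf := hT.isTree.OT_suppress hlv hl0 (by simp [hempty]) hxl hyl
  obtain ⟨hkill, -⟩ | ⟨hkill, hp, hp0, hcard⟩ := h.kill_cases hT.isTree
  · rw [hkill, hleaf]
  · rw [hkill, (hT.isTree.suppress hlv hl0).OT_suppress hp hp0 hcard.le
      (h.apply_parent hT.isTree hx) (h.apply_parent hT.isTree hy), hleaf]

theorem CanKill.attracts_kill (hT : T.IsSimpleTree) (h : T.CanKill l) {φ : ℝ → ℝ} (hφ : φ 0 = 0)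
    (hA : ∀ i ∈ T.leaves, T.Attracts k φ i) :
    ∀ i ∈ (T.kill l).leaves, (T.kill l).Attracts k φ i := by
  intro i hi y hy hyi
  have hleaves := h.leaves_kill hT
  obtain ⟨hyT, hyl⟩ := (h.mem_configs_kill hT).1 hy
  obtain ⟨j, hj, hji, hyj, hgain⟩ := hA i (Finset.mem_of_mem_erase (hleaves ▸ hi)) y hyT hyi
  have hj' : j ∈ (T.kill l).leaves := by
    rw [hleaves]
    refine Finset.mem_erase.2 ⟨?_, hj⟩
    rintro rfl
    omega
  have htransfer := transfer_mem_configs hj' hi hyj hy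
  refine ⟨j, hj', hji, hyj, ?_⟩
  rwa [h.potential_kill hT hφ htransfer, h.potential_kill hT hφ hy, h.OT_kill hT hy htransfer]

end Kill

end WTree

/-! ### The greedy strategy -/

theorem exists_first_zero_of_affine {ι : Type*} {Z : Set ι} (hZ : Z.Finite) {a b : ι → ℝ}
    (ha : ∀ z ∈ Z, a z < 0) {r : ℝ} (hr : 0 < r) :
    ∃ s, 0 < s ∧ s ≤ r ∧ (∀ z ∈ Z, ∀ t, 0 ≤ t → t < s → a z + t * b z < 0) ∧
      (s = r ∨ ∃ z ∈ Z, a z + s * b z = 0) := by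
  induction Z, hZ using Set.Finite.induction_on with
  | empty => exact ⟨r, hr, le_rfl, by simp, Or.inl rfl⟩
  | @insert z Z _ _ ih =>
    obtain ⟨s, hs, hsr, hneg, hend⟩ := ih fun z' hz' => ha z' (Set.mem_insert_of_mem z hz')
    have haz := ha z (Set.mem_insert z Z)
    rcases le_or_gt (a z + s * b z) 0 with hz | hz
    · refine ⟨s, hs, hsr, Set.forall_mem_insert.2 ⟨fun t ht hts => ?_, hneg⟩,
        hend.imp_right fun ⟨z', hz', h⟩ => ⟨z', Set.mem_insert_of_mem z hz', h⟩⟩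
      nlinarith
    · have hbz : 0 < b z := by
        by_contra! hbz
        nlinarith
      have hzero : a z + -a z / b z * b z = 0 := by
        rw [div_mul_cancel₀ _ hbz.ne', add_neg_cancel]
      have hlt : -a z / b z < s := by
        rw [div_lt_iff₀ hbz]
        linarith
      refine ⟨-a z / b z, div_pos (neg_pos.2 haz) hbz, hlt.le.trans hsr,
        Set.forall_mem_insert.2 ⟨fun t _ ht => ?_, fun z' hz' t ht hts =>
          hneg z' hz' t ht (hts.trans hlt)⟩, Or.inr ⟨z, Set.mem_insert z Z, hzero⟩⟩
      rw [lt_div_iff₀ hbz] at ht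
      linarith

namespace WTree

variable {T : WTree} {k : ℕ} {φ : ℝ → ℝ} {x : ℕ → ℕ}

/-- `x'` minimizes `Ψ + O` among the configurations on `T`, and has the least potential among the
minimizers. If `O` is the transport from `x`, these ties are broken in favor of `x' ≠ x`. -/
def IsBest (T : WTree) (k : ℕ) (φ : ℝ → ℝ) (O : (ℕ → ℕ) → ℝ) (x' : ℕ → ℕ) : Prop :=
  x' ∈ T.configs k ∧ ∀ z ∈ T.configs k,
    toLex (T.potential φ x' + O x', T.potential φ x')
      ≤ toLex (T.potential φ z + O z, T.potential φ z)

theorem IsTree.exists_isBest (hT : T.IsTree) (k : ℕ) (φ : ℝ → ℝ) (O : (ℕ → ℕ) → ℝ) :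
    ∃ x', T.IsBest k φ O x' := by
  obtain ⟨l, hl⟩ := hT.leaves_nonempty
  exact Set.exists_min_image (T.configs k)
    (fun z => toLex (T.potential φ z + O z, T.potential φ z)) (T.configs_finite k)
    ⟨_, single_mem_configs hl k⟩

theorem IsBest.le {O : (ℕ → ℕ) → ℝ} {x' z : ℕ → ℕ} (h : T.IsBest k φ O x')
    (hz : z ∈ T.configs k) : T.potential φ x' + O x' ≤ T.potential φ z + O z :=
  (Prod.Lex.toLex_le_toLex.1 (h.2 z hz)).elim le_of_lt fun h => h.1.le

theorem IsBest.strictlyStable (hT : T.IsTree) {O : (ℕ → ℕ) → ℝ} {x' : ℕ → ℕ}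
    (h : T.IsBest k φ O x') (hO : ∀ z ∈ T.configs k, O z ≤ O x' + T.OT x' z) :
    T.StrictlyStable k φ x' := by
  intro z hz hne
  by_contra! hgain
  have hOz := hO z hz
  have hnonneg := hT.OT_nonneg x' z
  rcases Prod.Lex.toLex_le_toLex.1 (h.2 z hz) with hlt | ⟨-, hle⟩
  · dsimp only at hlt
    linarith
  · dsimp only at hle
    exact hne (hT.eq_of_OT_eq_zero h.1 hz (by linarith)).symm

theorem StrictlyStable.eq_of_isBest {x' : ℕ → ℕ} (h : T.StrictlyStable k φ x)
    (hx : x ∈ T.configs k) (hbest : T.IsBest k φ (T.OT x) x') : x' = x := by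
  by_contra hne
  have hlt := h x' hbest.1 hne
  have hle := hbest.le hx
  rw [OT_self] at hle
  linarith

open Classical in
/-- The cost of the transport from `x` to a configuration on `T'`: it takes place in `T` if `T'`
arises by a kill, and in `T'` otherwise. -/
noncomputable def transport (T : WTree) (x : ℕ → ℕ) (T' : WTree) : (ℕ → ℕ) → ℝ :=
  if ∃ l, T.CanKill l ∧ T' = T.kill l then T.OT x else T'.OT x

theorem IsTree.transport_of_subset (hT : T.IsTree) (x : ℕ → ℕ) {T' : WTree}
    (h : T.verts ⊆ T'.verts) : T.transport x T' = T'.OT x := by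
  refine if_neg ?_
  rintro ⟨l, hl, rfl⟩
  exact Finset.notMem_erase l _ (hl.verts_kill_subset hT (h (mem_leaves.1 hl.1).1))

theorem CanKill.transport_kill {l : ℕ} (h : T.CanKill l) (x : ℕ → ℕ) :
    T.transport x (T.kill l) = T.OT x :=
  if_pos ⟨l, h, rfl⟩

/-- A fork with edges of length `δ` costs less, even if all robots ended up on one new leaf, than
what is lost by a robot that moves between old leaves of `T`. The bound on the lengths of the old
edges makes the new leaves attractive. -/
def SmallLength (T : WTree) (k : ℕ) (φ : ℝ → ℝ) (x : ℕ → ℕ) (δ : ℝ) : Prop :=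
  (∀ z ∈ T.configs k, z ≠ x →
    T.potential φ x + δ * (φ k + k) < T.potential φ z + T.OT x z) ∧
  ∀ l ∈ T.leaves, l ≠ 0 → δ * (φ k + k) < T.len l

open Filter Topology in
theorem IsTree.exists_smallLength (hT : T.IsTree) (hst : T.StrictlyStable k φ x) :
    ∃ δ, 0 < δ ∧ δ < 1 ∧ T.SmallLength k φ x δ := by
  have hlim {a b : ℝ} (hab : a < b) : ∀ᶠ δ in 𝓝[>] (0 : ℝ), a + δ * (φ k + k) < b :=
    (((continuous_const.add (continuous_id.mul continuous_const)).tendsto' 0 a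
      (by simp)).eventually_lt_const hab).filter_mono nhdsWithin_le_nhds
  have hmoves : ∀ᶠ δ in 𝓝[>] (0 : ℝ), ∀ z ∈ T.configs k, z ≠ x →
      T.potential φ x + δ * (φ k + k) < T.potential φ z + T.OT x z := by
    rw [eventually_all_finite (T.configs_finite k)]
    intro z hz
    rw [eventually_imp_distrib_left]
    exact fun hzx => hlim (hst z hz hzx)
  have hedges : ∀ᶠ δ in 𝓝[>] (0 : ℝ), ∀ l ∈ T.leaves, l ≠ 0 → δ * (φ k + k) < T.len l := by
    rw [eventually_all_finset]
    intro l hl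
    rw [eventually_imp_distrib_left]
    exact fun hl0 => by simpa only [zero_add] using hlim (hT.len_pos l (mem_leaves.1 hl).1 hl0)
  have hone : ∀ᶠ δ in 𝓝[>] (0 : ℝ), δ < 1 :=
    (eventually_lt_nhds zero_lt_one).filter_mono nhdsWithin_le_nhds
  obtain ⟨δ, hδ, hδ1, hsmall⟩ :=
    ((eventually_mem_nhdsWithin).and (hone.and (hmoves.and hedges))).exists
  exact ⟨δ, hδ, hδ1, hsmall⟩

/-- The states of the game in which the greedy player has no reason to move. -/
structure AtRest (T : WTree) (k : ℕ) (φ : ℝ → ℝ) (x : ℕ → ℕ) : Prop where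
  isSimpleTree : T.IsSimpleTree
  config : x ∈ T.configs k
  strictlyStable : T.StrictlyStable k φ x

theorem eq_single_of_leaves_eq {l : ℕ} (hl : T.leaves = {l}) (hx : x ∈ T.configs k) :
    x = Pi.single l k := by
  obtain ⟨h0, hsum⟩ := hx
  rw [hl, Finset.sum_singleton] at hsum
  funext u
  rcases eq_or_ne u l with rfl | hu
  · rw [hsum, Pi.single_eq_same]
  · rw [Pi.single_eq_of_ne hu, h0 u (by rwa [hl, Finset.mem_singleton])]

theorem IsSimpleTree.atRest_single (hT : T.IsSimpleTree) {l : ℕ} (hl : T.leaves = {l}) :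
    T.AtRest k φ (Pi.single l k) :=
  ⟨hT, single_mem_configs (by rw [hl]; exact Finset.mem_singleton_self l) k,
    fun _ hz hne => absurd (eq_single_of_leaves_eq hl hz) hne⟩

end WTree

open Classical in
/-- The greedy strategy for the potential given by `φ`, with ties broken in favor of a small
potential. The new edges of a fork are so short that no robot leaves the forked leaf. -/
noncomputable def greedy (φ : ℝ → ℝ) (k : ℕ) : Strategy k where
  move T x T' := epsilon (T'.IsBest k φ (T.transport x T'))
  forkLength T x _ _ :=
    if h : ∃ δ, 0 < δ ∧ δ < 1 ∧ T.SmallLength k φ x δ then h.choose else 1 / 2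
  move_mem T x T' _ _ hT' :=
    (epsilon_spec (hT'.isTree.exists_isBest k φ (T.transport x T'))).1
  forkLength_pos T x _ _ := by
    split_ifs with h
    exacts [h.choose_spec.1, one_half_pos]
  forkLength_lt_one T x _ _ := by
    split_ifs with h
    exacts [h.choose_spec.2.1, one_half_lt_one]

section Greedy

open WTree

variable {T : WTree} {k : ℕ} {φ : ℝ → ℝ} {x : ℕ → ℕ} {l : ℕ} {S : Finset ℕ} {δ : ℝ}

theorem greedy_move_isBest {T' : WTree} (hT' : T'.IsTree) :
    T'.IsBest k φ (T.transport x T') ((greedy φ k).move T x T') :=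
  Classical.epsilon_spec (hT'.exists_isBest k φ (T.transport x T'))

theorem greedy_respond_isBest (hT : T.IsTree) :
    T.IsBest k φ (T.OT x) ((greedy φ k).respond T x) := by
  have h := greedy_move_isBest (k := k) (φ := φ) (T := T) (x := x) hT
  rwa [hT.transport_of_subset x subset_rfl] at h

theorem greedy_fork_isBest (hT : T.IsTree) (hF : T.CanFork x l S) (hδ : 0 < δ) :
    (T.fork l S δ).IsBest k φ ((T.fork l S δ).OT x) ((greedy φ k).move T x (T.fork l S δ)) := by
  have h := greedy_move_isBest (k := k) (φ := φ) (T := T) (x := x)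
    (hT.fork hF.2.1 (mem_leaves.1 hF.1).1 hδ)
  rwa [hT.transport_of_subset x Finset.subset_union_left] at h

theorem greedy_kill_isBest (hT : T.IsSimpleTree) (hK : T.CanKill l) :
    (T.kill l).IsBest k φ (T.OT x) ((greedy φ k).move T x (T.kill l)) := by
  have h := greedy_move_isBest (k := k) (φ := φ) (T := T) (x := x) (hK.isSimpleTree_kill hT).isTree
  rwa [hK.transport_kill] at h

theorem greedy_respond_strictlyStable (hT : T.IsTree) :
    T.StrictlyStable k φ ((greedy φ k).respond T x) :=
  (greedy_respond_isBest hT).strictlyStable hT fun z _ => hT.OT_triangle _ _ z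

theorem greedy_isGreedy (φ : ℝ → ℝ) (k : ℕ) : (greedy φ k).IsGreedy φ where
  stay _ _ hT _ _ hz := (greedy_respond_isBest hT.isTree).le hz
  ties _ x hT _ hrest := by
    have h := greedy_respond_strictlyStable (k := k) (φ := φ) (x := x) hT.isTree
    rwa [hrest] at h
  fork _ _ _ _ _ hT _ hF hδ _ _ hz := (greedy_fork_isBest hT.isTree hF hδ).le hz
  kill _ _ _ hT _ hK _ hz := (greedy_kill_isBest hT hK).le hz

theorem greedy_smallLength (hT : T.IsTree) (hst : T.StrictlyStable k φ x) (l m : ℕ) :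
    T.SmallLength k φ x ((greedy φ k).forkLength T x l m) := by
  have h := hT.exists_smallLength hst
  rw [show (greedy φ k).forkLength T x l m = h.choose from dif_pos h]
  exact h.choose_spec.2.2

theorem WTree.StrictlyStable.greedy_respond (hT : T.IsTree) (h : T.StrictlyStable k φ x)
    (hx : x ∈ T.configs k) : (greedy φ k).respond T x = x :=
  h.eq_of_isBest hx (greedy_respond_isBest hT)

theorem WTree.AtRest.elongate (h : T.AtRest k φ x) (hE : T.CanElongate x l) {s : ℝ} (hs : 0 ≤ s) :
    (T.elongate l s).AtRest k φ ((greedy φ k).respond (T.elongate l s) x) := by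
  have hT' := h.isSimpleTree.elongate (mem_leaves.1 hE.1).1 hE.2.1 hs
  exact ⟨hT', (greedy_respond_isBest hT'.isTree).1, greedy_respond_strictlyStable hT'.isTree⟩

theorem WTree.AtRest.fork (h : T.AtRest k φ x) (hF : T.CanFork x l S) (hδ : 0 < δ) :
    (T.fork l S δ).AtRest k φ ((greedy φ k).move T x (T.fork l S δ)) := by
  have hT' := h.isSimpleTree.fork hF.2.1 hF.1 hF.2.2.1 hδ
  have hbest := greedy_fork_isBest (k := k) (φ := φ) h.isSimpleTree.isTree hF hδ
  exact ⟨hT', hbest.1, hbest.strictlyStable hT'.isTree fun z _ => hT'.isTree.OT_triangle _ _ z⟩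

theorem WTree.AtRest.kill (h : T.AtRest k φ x) (hK : T.CanKill l) :
    (T.kill l).AtRest k φ ((greedy φ k).move T x (T.kill l)) := by
  have hT := h.isSimpleTree
  have hT' := hK.isSimpleTree_kill hT
  have hbest := greedy_kill_isBest (k := k) (φ := φ) (x := x) hT hK
  refine ⟨hT', hbest.1, hbest.strictlyStable hT'.isTree fun z hz => ?_⟩
  rw [hK.OT_kill hT hbest.1 hz]
  exact hT.isTree.OT_triangle _ _ z

theorem atRest_of_reach {c : ℝ} (h : (greedy φ k).Reach T x c) : T.AtRest k φ x := by
  induction h with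
  | start T l hT hl => exact hT.atRest_single hl
  | wait T x _ _ ih =>
    rwa [ih.strictlyStable.greedy_respond ih.isSimpleTree.isTree ih.config]
  | elongate T x _ l s _ hE hs _ ih => exact ih.elongate hE hs.le
  | fork T x _ l S _ hF ih => exact ih.fork hF ((greedy φ k).forkLength_pos _ _ _ _)
  | kill T x _ l _ hK ih => exact ih.kill hK

theorem greedy_fork_le (hT : T.IsTree) (hx : x ∈ T.configs k) (hF : T.CanFork x l S)
    (hφ0 : φ 0 = 0) (hδ : 0 < δ) :
    (T.fork l S δ).potential φ ((greedy φ k).move T x (T.fork l S δ))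
        + (T.fork l S δ).OT x ((greedy φ k).move T x (T.fork l S δ))
      ≤ T.potential φ x + δ * (φ (x l) + x l) := by
  have hbest := greedy_fork_isBest (k := k) (φ := φ) hT hF hδ
  obtain ⟨hl, hS, hcard, -⟩ := hF
  obtain ⟨s, hs⟩ : S.Nonempty := Finset.card_pos.1 (two_pos.trans_le hcard)
  have hxS := config_eq_zero_of_disjoint hS hx
  obtain ⟨y, hy, hgather, hys, hyS⟩ := hT.exists_config_fork (δ := δ) hS hl hs hx
  have hpotential : ∑ s' ∈ S, φ (y s') = φ (x l) := by
    rw [Finset.sum_eq_single_of_mem s hs fun s' hs' hne => by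
      rw [hyS s' hs' hne, Nat.cast_zero, hφ0], hys]
  have htransport : ∑ s' ∈ S, |(x s' : ℝ) - y s'| = x l := by
    rw [Finset.sum_eq_single_of_mem s hs fun s' hs' hne => by
      rw [hyS s' hs' hne, hxS s' hs', sub_self, abs_zero], hxS s hs, hys, Nat.cast_zero, zero_sub,
      abs_neg, Nat.abs_cast]
  calc
    _ ≤ (T.fork l S δ).potential φ y + (T.fork l S δ).OT x y := hbest.le hy
    _ = T.potential φ x + δ * (φ (x l) + x l) := by
      rw [hT.potential_fork hS hl hδ, hT.OT_fork hS hl hδ, gather_eq_self hS hx, hgather, OT_self,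
        hpotential, htransport]
      ring

theorem gather_greedy_fork (hT : T.IsTree) (hx : x ∈ T.configs k) (hF : T.CanFork x l S)
    (hφ0 : φ 0 = 0) (hφ : Monotone fun n : ℕ => φ n) (hδ : 0 < δ)
    (hsmall : T.SmallLength k φ x δ) :
    gather l S ((greedy φ k).move T x (T.fork l S δ)) = x := by
  have hle := greedy_fork_le hT hx hF hφ0 hδ
  have hbest := greedy_fork_isBest (k := k) (φ := φ) hT hF hδ
  obtain ⟨hl, hS, hcard, -⟩ := hF
  have hne : S.Nonempty := Finset.card_pos.1 (two_pos.trans_le hcard)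
  set y := (greedy φ k).move T x (T.fork l S δ)
  by_contra hmoved
  have hloss := hsmall.1 _ (hT.gather_mem_configs hS hl hne hbest.1) hmoved
  have hxl : φ (x l) + x l ≤ φ k + k :=
    add_le_add (hφ (hT.apply_le hx l)) (Nat.cast_le.2 (hT.apply_le hx l))
  have hnew : 0 ≤ ∑ s ∈ S, φ (y s) := Finset.sum_nonneg fun s _ => by
    simpa only [Nat.cast_zero, hφ0] using hφ (Nat.zero_le (y s))
  have hnewOT : 0 ≤ ∑ s ∈ S, |(x s : ℝ) - y s| := Finset.sum_nonneg fun s _ => abs_nonneg _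
  rw [hT.potential_fork hS hl hδ, hT.OT_fork hS hl hδ, gather_eq_self hS hx] at hle
  linarith [mul_le_mul_of_nonneg_left hxl hδ.le, mul_nonneg hδ.le hnew, mul_nonneg hδ.le hnewOT]

/-- This is affine in the duration `t`, so that a configuration `z` overtakes `x` at a definite
instant. -/
theorem elongate_excess (hT : T.IsTree) (hl : l ∈ T.leaves) (hl0 : l ≠ 0) (φ : ℝ → ℝ)
    (x z : ℕ → ℕ) (t : ℝ) :
    (T.elongate l t).potential φ x - ((T.elongate l t).potential φ z + (T.elongate l t).OT x z)
      = (T.potential φ x - (T.potential φ z + T.OT x z))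
        + t * (φ (x l) - (φ (z l) + |(x l : ℝ) - z l|)) := by
  rw [hT.potential_elongate hl hl0, hT.potential_elongate hl hl0, hT.OT_elongate hl hl0]
  ring

open Filter Topology in
theorem stable_elongate_of_quietUntil (hT : T.IsTree) (hl : l ∈ T.leaves) (hl0 : l ≠ 0)
    {s : ℝ} (hs : 0 < s) (hq : (greedy φ k).QuietUntil T x l s) :
    (T.elongate l s).Stable k φ x := by
  intro z hz
  rw [← sub_nonpos, elongate_excess hT hl hl0]
  have hlim : Tendsto (fun t => (T.potential φ x - (T.potential φ z + T.OT x z))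
      + t * (φ (x l) - (φ (z l) + |(x l : ℝ) - z l|))) (𝓝[<] s) (𝓝 _) :=
    ((continuous_const.add (continuous_id.mul continuous_const)).tendsto s).mono_left
      nhdsWithin_le_nhds
  refine le_of_tendsto hlim ?_
  filter_upwards [Ioo_mem_nhdsLT hs] with t ht
  have hbest := greedy_respond_isBest (k := k) (φ := φ) (x := x)
    (hT.elongate (mem_leaves.1 hl).1 hl0 ht.1.le)
  rw [hq t ht.1.le ht.2] at hbest
  have hle := hbest.le hz
  rw [OT_self, add_zero] at hle
  rwa [← elongate_excess hT hl hl0, sub_nonpos]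

theorem greedy_respond_elongate_lt (hT : T.IsTree) (hl : l ∈ T.leaves) (hl0 : l ≠ 0)
    (hφ : Monotone fun n : ℕ => φ n) (hx : x ∈ T.configs k) (hst : T.StrictlyStable k φ x)
    {s : ℝ} (hs : 0 < s) (hmove : (greedy φ k).respond (T.elongate l s) x ≠ x) :
    (greedy φ k).respond (T.elongate l s) x l < x l := by
  have hbest := greedy_respond_isBest (k := k) (φ := φ) (x := x)
    (hT.elongate (mem_leaves.1 hl).1 hl0 hs.le)
  set x' := (greedy φ k).respond (T.elongate l s) x
  have hle := hbest.le (z := x) hx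
  rw [OT_self, add_zero] at hle
  have hexcess := elongate_excess hT hl hl0 φ x x' s
  have hloss := hst x' hbest.1 hmove
  have hslope : 0 < φ (x l) - (φ (x' l) + |(x l : ℝ) - x' l|) :=
    pos_of_mul_pos_right (by linarith) hs.le
  by_contra! hxl
  linarith [hφ hxl, abs_nonneg ((x l : ℝ) - x' l)]

theorem exists_quiet_elongation (hT : T.IsTree) (hl : l ∈ T.leaves) (hl0 : l ≠ 0)
    (hφ : Monotone fun n : ℕ => φ n) (hx : x ∈ T.configs k) (hst : T.StrictlyStable k φ x)
    {r : ℝ} (hr : 0 < r) :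
    ∃ s, 0 < s ∧ s ≤ r ∧ (greedy φ k).QuietUntil T x l s ∧
      (s = r ∨ (greedy φ k).respond (T.elongate l s) x l < x l) := by
  obtain ⟨s, hs, hsr, hneg, hend⟩ := exists_first_zero_of_affine (Z := T.configs k \ {x})
    (a := fun z => T.potential φ x - (T.potential φ z + T.OT x z))
    (b := fun z => φ (x l) - (φ (z l) + |(x l : ℝ) - z l|))
    (T.configs_finite k).sdiff (fun z hz => sub_neg.2 (hst z hz.1 hz.2)) hr
  simp only [← elongate_excess hT hl hl0] at hneg hend
  have hT' {t : ℝ} (ht : 0 ≤ t) := hT.elongate (mem_leaves.1 hl).1 hl0 ht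
  refine ⟨s, hs, hsr, fun t ht hts => ?_, hend.imp_right fun ⟨z, hz, hzero⟩ => ?_⟩
  · exact StrictlyStable.greedy_respond (hT' ht)
      (fun z hz hne => sub_neg.1 (hneg z ⟨hz, hne⟩ t ht hts)) hx
  · refine greedy_respond_elongate_lt hT hl hl0 hφ hx hst hs fun hrest => ?_
    have hst' := greedy_respond_strictlyStable (k := k) (φ := φ) (x := x) (hT' hs.le)
    rw [hrest] at hst'
    exact (hst' z hz.1 hz.2).ne (sub_eq_zero.1 hzero)

/-- By induction on `x l`: every move of the player takes robots away from the elongated leaf. -/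
theorem WTree.AtRest.sustains (h : T.AtRest k φ x) (hφ : Monotone fun n : ℕ => φ n)
    (hl : l ∈ T.leaves) (hl0 : l ≠ 0) {r : ℝ} (hr : 0 ≤ r) : (greedy φ k).Sustains l T x r := by
  induction hn : x l using Nat.strong_induction_on generalizing T x r with
  | h n ih =>
  subst hn
  rcases Nat.lt_or_ge 1 (x l) with hxl | hxl
  swap
  · exact .blocked T x r hxl
  rcases hr.eq_or_lt with rfl | hr
  · exact .done T x
  obtain ⟨s, hs, hsr, hquiet, hend⟩ := exists_quiet_elongation h.isSimpleTree.isTree hl hl0 hφ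
    h.config h.strictlyStable hr
  refine .elongate T x r s hxl hs hsr hquiet ?_
  rcases hend with rfl | hlt
  · rw [sub_self]
    exact .done _ _
  · exact ih _ hlt (h.elongate ⟨hl, hl0, hxl⟩ hs.le) hl (sub_nonneg.2 hsr) rfl

theorem greedy_isLegal (hφ0 : φ 0 = 0) (hφ : Monotone fun n : ℕ => φ n) :
    (greedy φ k).IsLegal where
  fork_keeps T x c l S hR hF u hu hul := by
    have h := atRest_of_reach hR
    have hT := h.isSimpleTree.isTree
    have hgather := gather_greedy_fork hT h.config hF hφ0 hφ ((greedy φ k).forkLength_pos _ _ _ _)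
      (greedy_smallLength hT h.strictlyStable l S.card)
    exact (gather_of_ne hul (notMem_of_mem_leaves hF.2.1 hu)).symm.trans (congrFun hgather u)
  sustains T x c l r hR hE hr := (atRest_of_reach hR).sustains hφ hE.1 hE.2.1 hr.le

end Greedy

/-! ### The cost of the greedy strategy -/

theorem monotone_phi (k : ℕ) : Monotone fun n : ℕ => phi k n := by
  intro m n h
  simp only [phi]
  gcongr

theorem linear_le_phi (k m : ℕ) : 20 * (k : ℝ) * m ≤ phi k m :=
  le_add_of_nonneg_right (by positivity)

theorem phi_add_le {k m n : ℕ} (hm : 2 ≤ m) (hmk : m ≤ k) (hmn : m ≤ n + 1) :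
    phi k m + m ≤ 21 * (20 * (k : ℝ) * n) := by
  have hm2n : (m : ℝ) ≤ 2 * n := by exact_mod_cast (by omega : m ≤ 2 * n)
  have hm1 : (1 : ℝ) ≤ m := by exact_mod_cast (one_le_two.trans hm)
  have hmk' : (m : ℝ) ≤ k := by exact_mod_cast hmk
  simp only [phi]
  nlinarith [mul_le_mul_of_nonneg_left hm2n (Nat.cast_nonneg (α := ℝ) k)]

section Cost

open WTree

variable {T : WTree} {k : ℕ} {x : ℕ → ℕ} {c : ℝ} {l : ℕ} {S : Finset ℕ} {δ : ℝ}

/-- The invariant of the greedy player with `k` robots who has configuration `x` on `T` and has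
paid `c`. The factor `21` is that of `exists_evacuation`. -/
structure Invariant (k : ℕ) (T : WTree) (x : ℕ → ℕ) (c : ℝ) : Prop extends
    T.AtRest k (phi k) x where
  bound : ∀ z ∈ T.configs k, c + T.potential (phi k) x ≤ 21 * T.potential (phi k) z
  attracts : ∀ i ∈ T.leaves, T.Attracts k (phi k) i

theorem Invariant.start (hk : 0 < k) (hT : T.IsSimpleTree) (hl : T.leaves = {l}) :
    Invariant k T (Pi.single l k) 0 := by
  refine ⟨hT.atRest_single hl, fun z hz => ?_, fun i hi y hy hyi => ?_⟩
  · rw [eq_single_of_leaves_eq hl hz]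
    linarith [hT.isTree.potential_nonneg (phi_nonneg k) (Pi.single l k)]
  · rw [hl, Finset.mem_singleton] at hi
    rw [eq_single_of_leaves_eq hl hy, hi, Pi.single_eq_same] at hyi
    exact absurd hyi hk.ne'

theorem Invariant.wait (h : Invariant k T x c) :
    Invariant k T ((greedy (phi k) k).respond T x)
      (c + T.OT x ((greedy (phi k) k).respond T x)) := by
  rwa [h.strictlyStable.greedy_respond h.isSimpleTree.isTree h.config, OT_self, add_zero]

/-- Against the minimizer `z₀` of the potential the player loses nothing, since an elongation by `s`
costs the player `s * (φ (x l) + x l)` and raises the bound by `21 * s * φ (z₀ l)`. -/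
theorem Invariant.elongate (hk : 2 ≤ k) (h : Invariant k T x c) (hE : T.CanElongate x l) {s : ℝ}
    (hs : 0 < s) (hq : (greedy (phi k) k).QuietUntil T x l s) :
    Invariant k (T.elongate l s) ((greedy (phi k) k).respond (T.elongate l s) x)
      (c + s * x l + (T.elongate l s).OT x ((greedy (phi k) k).respond (T.elongate l s) x)) := by
  have hrest := h.toAtRest.elongate hE hs.le
  obtain ⟨hl, hl0, hxl⟩ := hE
  have hT := h.isSimpleTree.isTree
  have hlv := (mem_leaves.1 hl).1
  have hT' := hT.elongate hlv hl0 hs.le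
  have hst := stable_elongate_of_quietUntil hT hl hl0 hs hq
  refine ⟨hrest, fun z hz => ?_,
    hT.attracts_elongate hk h.config hl hl0 hxl hs.le hst h.attracts⟩
  obtain ⟨z₀, hz₀, hmin⟩ := Set.exists_min_image ((T.elongate l s).configs k)
    ((T.elongate l s).potential (phi k)) ((T.elongate l s).configs_finite k) ⟨x, h.config⟩
  have hz₀l : x l ≤ z₀ l + 1 := by
    by_contra! hgap
    obtain ⟨j, hj, -, hyj, hgain⟩ := hT'.exists_gain hk (x := x) h.config hz₀ hst hl hgap
    linarith [hmin _ (transfer_mem_configs hj hl hyj hz₀),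
      hT'.OT_nonneg z₀ (transfer z₀ j l), hT'.len_pos l hlv hl0]
  have hmove := (greedy_respond_isBest (k := k) (φ := phi k) (x := x) hT').le (z := x) h.config
  rw [OT_self, add_zero, hT.potential_elongate hl hl0 s _ x] at hmove
  have hz := hmin z hz
  rw [hT.potential_elongate hl hl0 s _ z₀] at hz
  have hrate : phi k (x l) + x l ≤ 21 * phi k (z₀ l) :=
    (phi_add_le hxl (hT.apply_le h.config l) hz₀l).trans (by gcongr; exact linear_le_phi k _)
  linarith [h.bound z₀ hz₀, mul_le_mul_of_nonneg_left hrate hs.le]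

/-- A configuration with far fewer than `x l` robots in the fork is more expensive than the minimum
by the length of an old edge; all others pay for the new edges at the same rate as `x`. -/
theorem Invariant.bound_fork (hk : 2 ≤ k) (h : Invariant k T x c) (hF : T.CanFork x l S)
    (hδ : 0 < δ) (hsmall : T.SmallLength k (phi k) x δ) {z : ℕ → ℕ}
    (hz : z ∈ (T.fork l S δ).configs k) :
    c + T.potential (phi k) x + δ * (phi k (x l) + x l)
      ≤ 21 * (T.fork l S δ).potential (phi k) z := by
  obtain ⟨hl, hS, hcard, hxl⟩ := hF
  have hT := h.isSimpleTree.isTree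
  have hne : S.Nonempty := Finset.card_pos.1 (two_pos.trans_le hcard)
  have hzT := hT.gather_mem_configs hS hl hne hz
  have hxk := hT.apply_le h.config l
  have hsum : 20 * (k : ℝ) * gather l S z l ≤ ∑ s ∈ S, phi k (z s) := by
    rw [gather_self, hT.config_fork_self hS hl hne hz, zero_add, Nat.cast_sum, Finset.mul_sum]
    exact Finset.sum_le_sum fun s _ => linear_le_phi k _
  rw [hT.potential_fork hS hl hδ]
  rcases le_or_gt (x l) (gather l S z l + 1) with hnear | hgap
  · have hrate := phi_add_le (by omega) hxk hnear
    linarith [h.bound _ hzT, mul_le_mul_of_nonneg_left hrate hδ.le,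
      mul_le_mul_of_nonneg_left hsum hδ.le]
  · obtain ⟨j, hj, hjl, hzj, hgain⟩ :=
      hT.exists_gain hk h.config hzT h.strictlyStable.stable hl hgap
    have hl0 := hT.leaf_ne_zero_of_ne hl (mem_leaves.1 hj).1 hjl
    have hxl : phi k (x l) + x l ≤ phi k k + k :=
      add_le_add (monotone_phi k hxk) (Nat.cast_le.2 hxk)
    have hnew : 0 ≤ ∑ s ∈ S, phi k (z s) := Finset.sum_nonneg fun s _ => phi_nonneg k _
    linarith [h.bound _ (transfer_mem_configs hj hl hzj hzT), hsmall.2 l hl hl0,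
      hT.OT_nonneg (gather l S z) (transfer (gather l S z) j l),
      mul_le_mul_of_nonneg_left hxl hδ.le, mul_nonneg hδ.le hnew,
      hT.len_pos l (mem_leaves.1 hl).1 hl0]

theorem Invariant.fork (hk : 2 ≤ k) (h : Invariant k T x c) (hF : T.CanFork x l S)
    (hδ : 0 < δ) (hsmall : T.SmallLength k (phi k) x δ) :
    Invariant k (T.fork l S δ) ((greedy (phi k) k).move T x (T.fork l S δ))
      (c + (T.fork l S δ).OT x ((greedy (phi k) k).move T x (T.fork l S δ))) := by
  have hT := h.isSimpleTree.isTree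
  refine ⟨h.toAtRest.fork hF hδ, fun z hz => ?_,
    hT.attracts_fork hk h.config h.strictlyStable.stable hF hδ (hsmall.2 l hF.1) h.attracts⟩
  linarith [greedy_fork_le hT h.config hF (phi_zero k) hδ, h.bound_fork hk hF hδ hsmall hz]

theorem Invariant.kill (hk : 2 ≤ k) (h : Invariant k T x c) (hK : T.CanKill l) :
    Invariant k (T.kill l) ((greedy (phi k) k).move T x (T.kill l))
      (c + T.OT x ((greedy (phi k) k).move T x (T.kill l))) := by
  have hT := h.isSimpleTree
  refine ⟨h.toAtRest.kill hK, fun y hy => ?_, hK.attracts_kill hT (phi_zero k) h.attracts⟩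
  obtain ⟨hyT, hyl⟩ := (hK.mem_configs_kill hT).1 hy
  obtain ⟨w, hw, hwl, z, hz, hevacuate⟩ :=
    hT.isTree.exists_evacuation hk h.config hyT hK.1 hyl (h.attracts l hK.1)
  have hw' := (hK.mem_configs_kill hT).2 ⟨hw, hwl⟩
  have hbest := (greedy_kill_isBest (φ := phi k) (x := x) hT hK).le hw'
  rw [hK.potential_kill hT (phi_zero k) hw'] at hbest
  rw [hK.potential_kill hT (phi_zero k) hy]
  linarith [h.bound z hz]

theorem invariant_of_reach (hk : 2 ≤ k) (h : (greedy (phi k) k).Reach T x c) :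
    Invariant k T x c := by
  induction h with
  | start T l hT hl => exact .start (two_pos.trans_le hk) hT hl
  | wait T x c _ ih => exact ih.wait
  | elongate T x c l s _ hE hs hq ih => exact ih.elongate hk hE hs hq
  | fork T x c l S _ hF ih =>
    exact ih.fork hk hF ((greedy (phi k) k).forkLength_pos _ _ _ _)
      (greedy_smallLength ih.isSimpleTree.isTree ih.strictlyStable _ _)
  | kill T x c l _ hK ih => exact ih.kill hk hK

theorem potential_single {φ : ℝ → ℝ} (hφ : φ 0 = 0) {v : ℕ} (hv : v ∈ T.verts) (n : ℕ) :
    T.potential φ (Pi.single v n) = φ n * T.depth v := by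
  classical
  rw [potential, depth, Finset.mul_sum, Finset.sum_filter]
  refine Finset.sum_congr rfl fun u _ => ?_
  rw [mass_single hv]
  split_ifs
  · exact mul_comm _ _
  · rw [Nat.cast_zero, hφ, mul_zero]

theorem exists_leaf_depth_eq (hT : T.IsTree) : ∃ v ∈ T.leaves, T.depth v = T.highestLeafDepth :=
  ((Finset.coe_nonempty.2 hT.leaves_nonempty).image T.depth).csInf_mem
    (T.leaves.finite_toSet.image _)

theorem greedy_cost_le (hk : 2 ≤ k) (hR : (greedy (phi k) k).Reach T x c) :
    c ≤ 525 * (k : ℝ) ^ 2 * T.highestLeafDepth := by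
  have h := invariant_of_reach hk hR
  have hT := h.isSimpleTree.isTree
  obtain ⟨v, hv, hdepth⟩ := exists_leaf_depth_eq hT
  calc
    c ≤ c + T.potential (phi k) x := le_add_of_nonneg_right (hT.potential_nonneg (phi_nonneg k) x)
    _ ≤ 21 * T.potential (phi k) (Pi.single v k) := h.bound _ (single_mem_configs hv k)
    _ = 525 * (k : ℝ) ^ 2 * T.highestLeafDepth := by
      rw [potential_single (phi_zero k) (mem_leaves.1 hv).1, hdepth, phi]
      ring

end Cost

end CTM

theorem mainTheorem3 :
    ∃ f : ℕ → ℝ → ℝ,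
      (∃ C : ℝ, ∀ k : ℕ, 2 ≤ k → ∀ D : ℝ, 0 ≤ D → |f k D| ≤ C * (k : ℝ) ^ 2 * D) ∧
      ∀ k : ℕ, 2 ≤ k → ∃ A : CTM.Strategy k,
        A.IsGreedy (fun y : ℝ => 20 * (k : ℝ) * y + 5 * y ^ 2) ∧ A.IsBounded f := by
  refine ⟨fun k D => 525 * (k : ℝ) ^ 2 * D, ⟨525, fun k _ D hD => ?_⟩, fun k hk =>
    ⟨CTM.greedy (CTM.phi k) k, CTM.greedy_isGreedy _ k,
      CTM.greedy_isLegal (CTM.phi_zero k) (CTM.monotone_phi k),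
      fun T x c hR => CTM.greedy_cost_le hk hR⟩⟩
  rw [abs_of_nonneg (by positivity)]
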